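/- Let $n\ge 3$. Consider $2n$ points on the unit circle labelled clockwise $1_\circ,2_\bullet,3_\circ,\dots,(2n-1)_\circ,(2n)_\bullet$. The hollow (resp. solid) polygon is the convex hull of the odd (resp. even) points; its diagonals are the segments joining two of its vertices, boundary edges being external diagonals and the others internal ones. A dissection is a set of pairwise non-crossing internal diagonals of the hollow (or of the solid) polygon; a triangulation is a dissection whose cells are all triangles. For a hollow dissection $D_\circ$, let $\overline D_\circ$ be $D_\circ$ together with all boundary edges of the hollow polygon. A solid diagonal $\delta_\bullet$ is a $D_\circ$-accordion diagonal if the elements of $\overline D_\circ$ that it crosses form a connected set, and a $D_\circ$-accordion dissection is a set of pairwise non-crossing internal $D_\circ$-accordion diagonals. The $\mathbf g$-vector $\mathbf g(D_\circ|\delta_\bullet)\in\mathbb R^{D_\circ}$ of a $D_\circ$-accordion diagonal $\delta_\bullet$ has the following coordinate at $\delta_\circ\in D_\circ$: it is $0$ if $\delta_\bullet$ does not cross $\delta_\circ$; otherwise let $\mu_\circ$ and $\nu_\circ$ be the other elements of $\overline D_\circ$ crossed by $\delta_\bullet$ in the two cells of $D_\circ$ containing $\delta_\circ$; the coordinate is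 $1$, $-1$ or $0$ according to whether $\mu_\circ\delta_\circ\nu_\circ$ is a path shaped like a $\mathsf Z$, a path shaped like an $\mathsf S$, or a $\mathsf V$ (the three diagonals share an endpoint). The $\mathbf g$-vector fan of $D_\circ$ is the collection of cones $$\mathcal F^{\mathbf g}(D_\circ)=\bigl\{\mathbb R_{\ge 0}\{\mathbf g(D_\circ|\delta_\bullet):\delta_\bullet\in D_\bullet\}\ :\ D_\bullet\text{ a }D_\circ\text{-accordion dissection}\bigr\}.$$ The $D_\circ$-accordiohedron is $$\mathrm{Acco}(D_\circ)=\bigl\{x\in\mathbb R^{D_\circ}:\langle \mathbf g(D_\circ|\gamma_\bullet),x\rangle\le h(D_\circ|\gamma_\bullet)\text{ for all }D_\circ\text{-accordion diagonals }\gamma_\bullet\bigr\},$$ where $h(D_\circ|\gamma_\bullet)$ is the number of $D_\circ$-accordion diagonals that cross $\gamma_\bullet$. When $D_\circ$ is a triangulation, this is the associahedron of Hohlweg, Pilaud and Stella. **Corollary.** For any hollow dissection $D_\circ$, the $\mathbf g$-vector fan $\mathcal F^{\mathbf g}(D_\circ)$ is realized by a coordinate projection of a Hohlweg–Pilaud–Stella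 associahedron. More precisely, there is a hollow triangulation $T_\circ\supseteq D_\circ$, and for every hollow triangulation $T_\circ\supseteq D_\circ$ the image of $\mathrm{Acco}(T_\circ)$ under the orthogonal projection $\mathbb R^{T_\circ}\to\mathbb R^{D_\circ}$ (which forgets the coordinates indexed by $T_\circ\smallsetminus D_\circ$) is a polytope whose normal fan is $\mathcal F^{\mathbf g}(D_\circ)$. -/

import Mathlib

open scoped NNReal

noncomputable section

namespace Accordion

/-- A segment joining two distinct vertices of a convex `n`-gon whose vertices are numbered
`0, …, n - 1` clockwise, recorded as the pair `(i, j)` of its endpoints with `i < j`. -/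
abbrev Chord (n : ℕ) : Type := {e : Fin n × Fin n // e.1 < e.2}

/-- Diagonals of the hollow polygon: the hollow vertex number `i` is the point labelled `2i + 1`
among the `2n` points on the circle. -/
abbrev HollowDiagonal (n : ℕ) : Type := Chord n

/-- Diagonals of the solid polygon: the solid vertex number `i` is the point labelled `2i + 2`
among the `2n` points on the circle. -/
abbrev SolidDiagonal (n : ℕ) : Type := Chord n

variable {n : ℕ}

/-- Smaller endpoint. -/
def Chord.left (e : Chord n) : Fin n := e.1.1

/-- Larger endpoint. -/
def Chord.right (e : Chord n) : Fin n := e.1.2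

/-- `v` is an endpoint of `e`. -/
def Chord.IsEndpoint (e : Chord n) (v : Fin n) : Prop := v = e.left ∨ v = e.right

/-- `u` and `v` are the two endpoints of `e`. -/
def Chord.Joins (e : Chord n) (u v : Fin n) : Prop :=
  (e.left = u ∧ e.right = v) ∨ (e.left = v ∧ e.right = u)

/-- Boundary edges (external diagonals) of the polygon. -/
def Chord.IsBoundary (e : Chord n) : Prop :=
  (e.right : ℕ) = e.left + 1 ∨ ((e.left : ℕ) = 0 ∧ (e.right : ℕ) + 1 = n)

/-- For labels `a < b` and `c < d` of points on a circle: the open segments `ab` and `cd` cross,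
with four distinct endpoints. -/
def Interlace (a b c d : ℕ) : Prop := (a < c ∧ c < b ∧ b < d) ∨ (c < a ∧ a < d ∧ d < b)

/-- Two diagonals of the same polygon cross. -/
def Chord.Cross (e f : Chord n) : Prop := Interlace e.left e.right f.left f.right

/-- A hollow diagonal and a solid diagonal cross (in terms of the labels `1, …, 2n`). -/
def MixedCross (e : HollowDiagonal n) (f : SolidDiagonal n) : Prop :=
  Interlace (2 * e.left + 1) (2 * e.right + 1) (2 * f.left + 2) (2 * f.right + 2)

/-- A dissection: a set of pairwise non-crossing internal diagonals. -/
structure IsDissection (D : Finset (Chord n)) : Prop where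
  internal : ∀ e ∈ D, ¬ e.IsBoundary
  nonCrossing : ∀ e ∈ D, ∀ f ∈ D, ¬ e.Cross f

/-- The dissection together with all boundary edges of the polygon. -/
def withBoundary (D : Finset (Chord n)) : Set (Chord n) := {e | e ∈ D ∨ e.IsBoundary}

/-- No diagonal of `D` has vertices of `C` strictly on both of its sides. -/
def NotSeparated (D : Finset (Chord n)) (C : Finset (Fin n)) : Prop :=
  ∀ g ∈ D, (∀ v ∈ C, g.left ≤ v ∧ v ≤ g.right) ∨ (∀ v ∈ C, v ≤ g.left ∨ g.right ≤ v)

/-- `C` is the vertex set of a cell of `D`: an inclusion-maximal set of at least three vertices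
of the polygon that is not separated by any diagonal of `D`. -/
def IsCell (D : Finset (Chord n)) (C : Finset (Fin n)) : Prop :=
  Maximal (fun C' : Finset (Fin n) => NotSeparated D C' ∧ 3 ≤ C'.card) C

/-- A triangulation: a dissection all of whose cells are triangles. -/
def IsTriangulation (D : Finset (Chord n)) : Prop :=
  IsDissection D ∧ ∀ C, IsCell D C → C.card = 3

/-- Two distinct diagonals are adjacent when they share an endpoint. -/
def incidenceGraph (n : ℕ) : SimpleGraph (Chord n) where
  Adj e f := e ≠ f ∧ ∃ v, e.IsEndpoint v ∧ f.IsEndpoint v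
  symm := ⟨fun _ _ h => ⟨h.1.symm, h.2.imp fun _ hv => ⟨hv.2, hv.1⟩⟩⟩
  loopless := ⟨fun _ h => h.1 rfl⟩

/-- The diagonals of the hollow dissection and the boundary edges of the hollow polygon that are
crossed by a solid diagonal. -/
def crossed (D : Finset (HollowDiagonal n)) (f : SolidDiagonal n) : Set (HollowDiagonal n) :=
  {e | e ∈ withBoundary D ∧ MixedCross e f}

/-- `f` is a `D`-accordion diagonal: the hollow diagonals and boundary edges that it crosses form a
connected set. -/
def IsAccordionDiagonal (D : Finset (HollowDiagonal n)) (f : SolidDiagonal n) : Prop :=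
  ((incidenceGraph n).induce (crossed D f)).Connected

/-- A `D`-accordion dissection: a set of pairwise non-crossing internal `D`-accordion diagonals. -/
def IsAccordionDissection (D : Finset (HollowDiagonal n)) (S : Finset (SolidDiagonal n)) : Prop :=
  IsDissection S ∧ ∀ f ∈ S, IsAccordionDiagonal D f

/-- The vertices `u, v, w` are distinct and appear in this cyclic order clockwise. -/
def Clockwise (u v w : Fin n) : Prop :=
  (u < v ∧ v < w) ∨ (v < w ∧ w < u) ∨ (w < u ∧ u < v)

/-- The path `t - u - v - w` has the shape of the letter Z: walking along it, one turns right at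
`u` and left at `v`. -/
def IsZ (t u v w : Fin n) : Prop := Clockwise t u v ∧ Clockwise w v u

/-- The path `t - u - v - w` has the shape of the letter S: walking along it, one turns left at
`u` and right at `v`. -/
def IsS (t u v w : Fin n) : Prop := Clockwise v u t ∧ Clockwise u v w

/-- The solid diagonal `f` crosses the hollow diagonal `e` of `D` and slaloms on it along the path
`t - u - v - w`: if `μ` and `ν` are the other diagonals or boundary edges crossed by `f` in the two
cells of `D` containing `e`, then `μ = tu`, `e = uv` and `ν = vw`. -/
def Slaloms (D : Finset (HollowDiagonal n)) (e : HollowDiagonal n) (f : SolidDiagonal n)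
    (t u v w : Fin n) : Prop :=
  MixedCross e f ∧ ∃ μ ∈ crossed D f, ∃ ν ∈ crossed D f, μ ≠ e ∧ ν ≠ e ∧
    (∃ C C', IsCell D C ∧ IsCell D C' ∧ C ≠ C' ∧
      (e.left ∈ C ∧ e.right ∈ C ∧ μ.left ∈ C ∧ μ.right ∈ C) ∧
      (e.left ∈ C' ∧ e.right ∈ C' ∧ ν.left ∈ C' ∧ ν.right ∈ C')) ∧
    μ.Joins t u ∧ e.Joins u v ∧ ν.Joins v w

open Classical in
/-- The sign of `f` on `e` in `D`: `1` if `f` slaloms on `e` along a Z, `-1` if along an S,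
and `0` otherwise. -/
def slalomSign (D : Finset (HollowDiagonal n)) (e : HollowDiagonal n) (f : SolidDiagonal n) : ℝ :=
  if ∃ t u v w, Slaloms D e f t u v w ∧ IsZ t u v w then 1
  else if ∃ t u v w, Slaloms D e f t u v w ∧ IsS t u v w then -1
  else 0

/-- The `g`-vector of `f` with respect to `D`, in the vector space with one coordinate for each
diagonal of `D`. -/
def gVector (D : Finset (HollowDiagonal n)) (f : SolidDiagonal n) : D → ℝ :=
  fun e => slalomSign D e f

/-- The `g`-vector fan of `D`, as a collection of cones: the nonnegative spans of the `g`-vectors of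
the `D`-accordion dissections. -/
def gVectorFan (D : Finset (HollowDiagonal n)) : Set (Set (D → ℝ)) :=
  {K | ∃ S : Finset (SolidDiagonal n), IsAccordionDissection D S ∧
    K = (Submodule.span ℝ≥0 (gVector D '' (S : Set (SolidDiagonal n))) : Set (D → ℝ))}

/-- The `D`-height of `f`: the number of `D`-accordion diagonals that cross `f`. -/
def height (D : Finset (HollowDiagonal n)) (f : SolidDiagonal n) : ℕ :=
  Set.ncard {f' : SolidDiagonal n | IsAccordionDiagonal D f' ∧ f'.Cross f}

/-- The `D`-accordiohedron; when `D` is a triangulation, this is the associahedron of Hohlweg,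
Pilaud and Stella. -/
def accordiohedron (D : Finset (HollowDiagonal n)) : Set (D → ℝ) :=
  {x | ∀ f : SolidDiagonal n, IsAccordionDiagonal D f → gVector D f ⬝ᵥ x ≤ (height D f : ℝ)}

/-- A polytope: the convex hull of finitely many points. -/
def IsPolytope {ι : Type*} (P : Set (ι → ℝ)) : Prop :=
  ∃ V : Set (ι → ℝ), V.Finite ∧ convexHull ℝ V = P

/-- The normal cone of `P` at `F`: the vectors whose scalar product attains its maximum over `P`
at every point of `F`. -/
def normalCone {ι : Type*} [Fintype ι] (P F : Set (ι → ℝ)) : Set (ι → ℝ) :=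
  {c | ∀ x ∈ F, ∀ y ∈ P, c ⬝ᵥ y ≤ c ⬝ᵥ x}

/-- The normal fan of `P`: the normal cones at the nonempty faces of `P` (including `P`). -/
def normalFan {ι : Type*} [Fintype ι] (P : Set (ι → ℝ)) : Set (Set (ι → ℝ)) :=
  {K | ∃ F : Set (ι → ℝ), F.Nonempty ∧ IsExposed ℝ P F ∧ K = normalCone P F}

/-- A collection of cones is realized by `P` when `P` is a polytope with this normal fan. -/
def IsRealizedBy {ι : Type*} [Fintype ι] (𝓕 : Set (Set (ι → ℝ))) (P : Set (ι → ℝ)) : Prop :=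
  IsPolytope P ∧ normalFan P = 𝓕

/-- For `D ⊆ T`, the orthogonal projection to the coordinate subspace indexed by `D`: it keeps the
coordinates of the diagonals in `D` and forgets the others. -/
def coordProjection {D T : Finset (HollowDiagonal n)} (h : D ⊆ T) : (T → ℝ) →ₗ[ℝ] (D → ℝ) :=
  LinearMap.funLeft ℝ ℝ fun e : D => (⟨e.1, h e.2⟩ : T)

end Accordion

end

open scoped NNReal

noncomputable section

namespace Accordion

variable {n : ℕ}

/-! ### Cyclic order and segments of the polygon -/

/-! The normal fan of a coordinate projection is the section of the normal fan upstairs by the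
coordinate subspace. Two things are needed: the normal fan of the associahedron of `T`, and the fact
that its section by the coordinates of `D` is the fan of `D`.

Everything rests on one reading of `g`-vectors. A solid diagonal cuts the hollow vertices into two
arcs, and for a triangulation `T` its coordinate at `e` is half an alternating sum of crossing
numbers with the four sides of the quadrilateral around `e`, that is, a shear coordinate
(`slalomSign_eq_crossing`).

For `D ⊆ T`, the `D`-accordion diagonals are exactly the solid diagonals whose `T`-coordinates
vanish outside `D`, and on `D` their two `g`-vectors agree
(`IsAccordionDiagonal.slalomSign_eq_zero`, `isAccordionDiagonal_of_slalomSign`,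
`IsAccordionDiagonal.slalomSign_eq`). Non-crossing diagonals never have opposite signs at the same
`e` (`sign_coherent`), so a nonnegative combination of non-crossing diagonals that lies in the
subspace of `D` uses only `D`-accordion diagonals. This identifies the section.

The fan of `T` is obtained directly. Resolving a crossing preserves the sum of `g`-vectors and
strictly lowers the sum of heights (`exists_exchange`), so diagonals whose inequalities are tight at
a common point do not cross. A tropical Ptolemy relation shows that nonnegative weights with
non-crossing support are determined, on internal diagonals, by the weighted sum of `g`-vectors
(`IsLamination.unique`). Hence the `g`-vectors of a dissection are independent, and maximizing a
form `c` over the compact polytope writes `c` in one and only one way as a combination of tight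
diagonals (`exists_lamination`). Normal cones are then read off in `normalCone_eq_span`. -/

/-- The vertices `a` and `b` are joined by a diagonal of `D` or by a boundary edge. -/
def Linked (D : Finset (Chord n)) (a b : Fin n) : Prop := ∃ e ∈ withBoundary D, e.Joins a b

/-- `b` is the clockwise successor of `a`. -/
def IsNext (a b : Fin n) : Prop := (b : ℕ) = a + 1 ∨ ((a : ℕ) + 1 = n ∧ (b : ℕ) = 0)

/-- The number of clockwise steps from `a` to `b`. -/
def arcLength (a b : Fin n) : ℕ := if a ≤ b then (b : ℕ) - a else n + b - a

theorem exists_isNext (a : Fin n) : ∃ b, IsNext a b := by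
  by_cases h : (a : ℕ) + 1 < n
  · exact ⟨⟨a + 1, h⟩, Or.inl rfl⟩
  · exact ⟨⟨0, by omega⟩, Or.inr ⟨by omega, rfl⟩⟩

theorem exists_isNext_left (b : Fin n) : ∃ a, IsNext a b := by
  by_cases h : (b : ℕ) = 0
  · exact ⟨⟨n - 1, by omega⟩, Or.inr ⟨by simp; omega, h⟩⟩
  · exact ⟨⟨b - 1, by omega⟩, Or.inl (by simp; omega)⟩

theorem Clockwise.rotate {a b c : Fin n} (h : Clockwise a b c) : Clockwise b c a := by
  unfold Clockwise at *; tauto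

theorem arcLength_lt_of_clockwise {a b c : Fin n} (h : Clockwise a b c) :
    arcLength a b < arcLength a c := by
  unfold Clockwise at h; unfold arcLength; split_ifs <;> omega

theorem arcLength_lt_of_clockwise' {a b c : Fin n} (h : Clockwise a b c) :
    arcLength b c < arcLength a c := by
  unfold Clockwise at h; unfold arcLength; split_ifs <;> omega

theorem exists_joins {a b : Fin n} (h : a ≠ b) : ∃ e : Chord n, e.Joins a b := by
  rcases lt_or_gt_of_ne h with h | h
  · exact ⟨⟨(a, b), h⟩, Or.inl ⟨rfl, rfl⟩⟩
  · exact ⟨⟨(b, a), h⟩, Or.inr ⟨rfl, rfl⟩⟩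

theorem Chord.Joins.symm {e : Chord n} {a b : Fin n} (h : e.Joins a b) : e.Joins b a := Or.symm h

theorem Chord.joins_self (e : Chord n) : e.Joins e.left e.right := Or.inl ⟨rfl, rfl⟩

theorem Chord.left_lt_right (e : Chord n) : e.left < e.right := e.2

theorem Chord.ext_ends {e f : Chord n} (h₁ : e.left = f.left) (h₂ : e.right = f.right) : e = f :=
  Subtype.ext (Prod.ext h₁ h₂)

theorem Chord.Joins.eq {e f : Chord n} {a b : Fin n} (he : e.Joins a b) (hf : f.Joins a b) :
    e = f := by
  have h₁ := e.left_lt_right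
  have h₂ := f.left_lt_right
  unfold Chord.Joins at *
  apply Chord.ext_ends <;> omega

theorem Linked.symm {D : Finset (Chord n)} {a b : Fin n} (h : Linked D a b) : Linked D b a := by
  obtain ⟨e, he, h⟩ := h
  exact ⟨e, he, h.symm⟩

theorem Linked.ne {D : Finset (Chord n)} {a b : Fin n} (h : Linked D a b) : a ≠ b := by
  obtain ⟨e, he, h⟩ := h
  have h₁ := e.left_lt_right
  unfold Chord.Joins at h
  omega

theorem Linked.mono {D T : Finset (Chord n)} (hDT : D ⊆ T) {a b : Fin n} (h : Linked D a b) :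
    Linked T a b := by
  obtain ⟨e, he, h⟩ := h
  exact ⟨e, he.imp_left fun h => hDT h, h⟩

theorem linked_of_mem {D : Finset (Chord n)} {e : Chord n} (he : e ∈ D) :
    Linked D e.left e.right := ⟨e, Or.inl he, e.joins_self⟩

theorem linked_of_isNext (hn : 3 ≤ n) (D : Finset (Chord n)) {a b : Fin n} (h : IsNext a b) :
    Linked D a b := by
  have hab : a ≠ b := by unfold IsNext at h; omega
  obtain ⟨e, he⟩ := exists_joins hab
  refine ⟨e, Or.inr ?_, he⟩
  have := e.left_lt_right
  unfold Chord.Joins at he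
  unfold IsNext at h
  unfold Chord.IsBoundary
  omega

theorem Chord.cross_iff (e f : Chord n) : e.Cross f ↔
    (Clockwise e.left f.left e.right ∧ Clockwise e.right f.right e.left) ∨
    (Clockwise e.left f.right e.right ∧ Clockwise e.right f.left e.left) := by
  have h₁ := e.left_lt_right
  have h₂ := f.left_lt_right
  unfold Chord.Cross Interlace Clockwise
  omega

theorem Chord.cross_comm (e f : Chord n) : e.Cross f ↔ f.Cross e := by
  have h₁ := e.left_lt_right
  have h₂ := f.left_lt_right
  unfold Chord.Cross Interlace
  omega

theorem Chord.Joins.cross_iff {e f : Chord n} {a b c d : Fin n} (he : e.Joins a b)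
    (hf : f.Joins c d) : e.Cross f ↔
    (Clockwise a c b ∧ Clockwise b d a) ∨ (Clockwise a d b ∧ Clockwise b c a) := by
  rw [Chord.cross_iff]
  rcases he with ⟨rfl, rfl⟩ | ⟨rfl, rfl⟩ <;> rcases hf with ⟨rfl, rfl⟩ | ⟨rfl, rfl⟩ <;> tauto

theorem Chord.IsBoundary.not_cross {e : Chord n} (he : e.IsBoundary) (f : Chord n) :
    ¬ e.Cross f := by
  have h₁ := e.left_lt_right
  have h₂ := f.left_lt_right
  unfold Chord.IsBoundary at he
  unfold Chord.Cross Interlace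
  omega

theorem IsDissection.not_cross {D : Finset (Chord n)} (hD : IsDissection D) {e f : Chord n}
    (he : e ∈ withBoundary D) (hf : f ∈ withBoundary D) : ¬ e.Cross f := by
  rcases he with he | he
  · rcases hf with hf | hf
    · exact hD.nonCrossing e he f hf
    · rw [Chord.cross_comm]; exact hf.not_cross e
  · exact he.not_cross f

theorem Linked.not_cross {D : Finset (Chord n)} (hD : IsDissection D) {a b c d : Fin n}
    (h : Linked D a b) (h' : Linked D c d) : ¬ (Clockwise a c b ∧ Clockwise b d a) := by
  obtain ⟨e, he, he'⟩ := h
  obtain ⟨f, hf, hf'⟩ := h'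
  have := hD.not_cross he hf
  rw [he'.cross_iff hf'] at this
  tauto

theorem Linked.exists_mem {D : Finset (Chord n)} {a b p q : Fin n} (h : Linked D a b)
    (hp : Clockwise a p b) (hq : Clockwise b q a) : ∃ e ∈ D, e.Joins a b := by
  obtain ⟨e, he | he, he'⟩ := h
  · exact ⟨e, he, he'⟩
  · exfalso
    have := e.left_lt_right
    unfold Chord.Joins at he'
    unfold Chord.IsBoundary at he
    unfold Clockwise at hp hq
    omega

theorem clockwise_of_isNext {a b p : Fin n} (hab : a ≠ b) (hp : IsNext a p) (h : ¬ IsNext a b) :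
    Clockwise a p b := by
  unfold IsNext Clockwise at *
  omega

theorem clockwise_of_isNext' {a b p : Fin n} (hab : a ≠ b) (hp : IsNext p a) (h : ¬ IsNext b a) :
    Clockwise b p a := by
  unfold IsNext Clockwise at *
  omega

theorem exists_last_clockwise (P : Fin n → Prop) {a b t : Fin n} (h : Clockwise a t b) (ht : P t) :
    ∃ p, Clockwise a p b ∧ P p ∧ (p = t ∨ Clockwise a t p) ∧ ∀ d, P d → ¬ Clockwise p d b := by
  obtain ⟨p, ⟨h₁, h₂, h₃⟩, hp⟩ := Set.exists_max_image
    {p | Clockwise a p b ∧ P p ∧ (p = t ∨ Clockwise a t p)} (arcLength a) (Set.toFinite _)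
    ⟨t, h, ht, Or.inl rfl⟩
  refine ⟨p, h₁, h₂, h₃, fun d hd hpd => ?_⟩
  have hd' : Clockwise a d b ∧ Clockwise a p d ∧ Clockwise a t d := by
    refine ⟨?_, ?_, ?_⟩
    · unfold Clockwise at *; omega
    · unfold Clockwise at *; omega
    · rcases h₃ with rfl | h₃ <;> unfold Clockwise at * <;> omega
  exact absurd (hp d ⟨hd'.1, hd, Or.inr hd'.2.2⟩) (arcLength_lt_of_clockwise hd'.2.1).not_ge

theorem exists_first_clockwise (P : Fin n → Prop) {a b t : Fin n} (h : Clockwise b t a)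
    (ht : P t) :
    ∃ p, Clockwise b p a ∧ P p ∧ (p = t ∨ Clockwise p t a) ∧ ∀ d, P d → ¬ Clockwise b d p := by
  obtain ⟨p, ⟨h₁, h₂, h₃⟩, hp⟩ := Set.exists_max_image
    {p | Clockwise b p a ∧ P p ∧ (p = t ∨ Clockwise p t a)} (fun p => arcLength p a)
    (Set.toFinite _) ⟨t, h, ht, Or.inl rfl⟩
  refine ⟨p, h₁, h₂, h₃, fun d hd hpd => ?_⟩
  have hd' : Clockwise b d a ∧ Clockwise d p a ∧ Clockwise d t a := by
    refine ⟨?_, ?_, ?_⟩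
    · unfold Clockwise at *; omega
    · unfold Clockwise at *; omega
    · rcases h₃ with rfl | h₃ <;> unfold Clockwise at * <;> omega
  exact absurd (hp d ⟨hd'.1, hd, Or.inr hd'.2.2⟩) (arcLength_lt_of_clockwise' hd'.2.1).not_ge

/-! ### Triangulations -/

/-- Take a maximal dissection. If a cell had four vertices, the chord from the first to the third
would cross nothing, so by maximality it would belong to the dissection and separate the second from
the fourth. -/
theorem exists_isTriangulation {D : Finset (Chord n)} (hD : IsDissection D) :
    ∃ T, IsTriangulation T ∧ D ⊆ T := by
  obtain ⟨T, hDT, hT⟩ := Finite.exists_le_maximal (p := fun T => IsDissection T) hD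
  refine ⟨T, ⟨hT.prop, fun C hC => le_antisymm ?_ hC.prop.2⟩, hDT⟩
  by_contra hcard
  rw [not_le] at hcard
  obtain ⟨s, hs, hs4⟩ := Finset.exists_subset_card_eq hcard
  let φ := s.orderEmbOfFin hs4
  have hφ : ∀ i, φ i ∈ C := fun i => hs (s.orderEmbOfFin_mem hs4 i)
  have h01 : φ 0 < φ 1 := φ.strictMono (by decide)
  have h12 : φ 1 < φ 2 := φ.strictMono (by decide)
  have h23 : φ 2 < φ 3 := φ.strictMono (by decide)
  let e : Chord n := ⟨(φ 0, φ 2), h01.trans h12⟩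
  have hel : e.left = φ 0 := rfl
  have her : e.right = φ 2 := rfl
  have heC : ∀ g ∈ T, ¬ g.Cross e := by
    intro g hg hge
    have h₁ := hC.prop.1 g hg
    have hg' := g.left_lt_right
    unfold Chord.Cross Interlace at hge
    rcases h₁ with h₁ | h₁ <;> have h₂ := h₁ _ (hφ 0) <;> have h₃ := h₁ _ (hφ 2) <;> omega
  have he : ¬ e.IsBoundary := by unfold Chord.IsBoundary; omega
  have hTe : IsDissection (insert e T) := by
    refine ⟨fun f hf => ?_, fun f hf g hg => ?_⟩
    · rcases Finset.mem_insert.1 hf with rfl | hf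
      exacts [he, hT.prop.internal f hf]
    · rcases Finset.mem_insert.1 hf with rfl | hf <;> rcases Finset.mem_insert.1 hg with rfl | hg
      · unfold Chord.Cross Interlace; omega
      · rw [Chord.cross_comm]; exact heC g hg
      · exact heC f hf
      · exact hT.prop.nonCrossing f hf g hg
  have heT : e ∈ T := hT.le_of_ge hTe (Finset.subset_insert _ _) (Finset.mem_insert_self _ _)
  rcases hC.prop.1 e heT with h | h
  · have := h _ (hφ 3); omega
  · have := h _ (hφ 1); omega

theorem exists_isCell {D : Finset (Chord n)} {C : Finset (Fin n)} (hC : NotSeparated D C)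
    (h3 : 3 ≤ C.card) : ∃ C', IsCell D C' ∧ C ⊆ C' := by
  obtain ⟨C', h, hC'⟩ := Finite.exists_le_maximal
    (p := fun C' : Finset (Fin n) => NotSeparated D C' ∧ 3 ≤ C'.card) ⟨hC, h3⟩
  exact ⟨C', hC', h⟩

theorem notSeparated_iff {D : Finset (Chord n)} {C : Finset (Fin n)} :
    NotSeparated D C ↔ ∀ g ∈ D, ∀ u ∈ C, ∀ v ∈ C,
      ¬ (Clockwise g.left u g.right ∧ Clockwise g.right v g.left) := by
  refine forall₂_congr fun g hg => ?_
  have := g.left_lt_right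
  constructor
  · intro h u hu v hv
    unfold Clockwise
    rcases h with h | h <;> have h₁ := h u hu <;> have h₂ := h v hv <;> omega
  · intro h
    by_contra! hne
    obtain ⟨⟨u, hu, hu'⟩, v, hv, hv'⟩ := hne
    refine h v hv u hu ?_
    unfold Clockwise
    constructor <;> by_cases g.left ≤ u <;> simp_all

/-- If `a` and `b` are not linked, then `a` has a nearest neighbour on each side of the segment
joining `a` and `b`. -/
theorem exists_neighbors (hn : 3 ≤ n) (D : Finset (Chord n)) {a b : Fin n} (hab : a ≠ b)
    (h : ¬ Linked D a b) : ∃ p q, Clockwise a p b ∧ Clockwise b q a ∧ Linked D a p ∧ Linked D a q ∧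
      ∀ d, Linked D a d → ¬ Clockwise p d q := by
  obtain ⟨s, hs⟩ := exists_isNext a
  obtain ⟨t, ht⟩ := exists_isNext_left a
  obtain ⟨p, hp, hap, -, hpmax⟩ := exists_last_clockwise (Linked D a)
    (clockwise_of_isNext hab hs fun h' => h (linked_of_isNext hn D h')) (linked_of_isNext hn D hs)
  obtain ⟨q, hq, haq, -, hqmax⟩ := exists_first_clockwise (Linked D a)
    (clockwise_of_isNext' hab ht fun h' => h (linked_of_isNext hn D h').symm)
    (linked_of_isNext hn D ht).symm
  refine ⟨p, q, hp, hq, hap, haq, fun d hd hpd => ?_⟩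
  have h₁ := hpmax d hd
  have h₂ := hqmax d hd
  have h₃ : d ≠ b := by rintro rfl; exact h hd
  unfold Clockwise at *
  omega

/-- Otherwise `a`, `b` and the two neighbours of `a` nearest to the segment `ab` on either side are
not separated, which yields a cell with at least four vertices. -/
theorem IsTriangulation.linked_of_not_cross (hn : 3 ≤ n) {T : Finset (Chord n)}
    (hT : IsTriangulation T) {a b : Fin n} (hab : a ≠ b)
    (h : ∀ c d, Linked T c d → ¬ (Clockwise a c b ∧ Clockwise b d a)) : Linked T a b := by
  by_contra hlink
  obtain ⟨p, q, hp, hq, hap, haq, hd⟩ := exists_neighbors hn T hab hlink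
  have hsep : NotSeparated T {a, p, b, q} := by
    rw [notSeparated_iff]
    intro g hg u hu v hv huv
    have hgl := linked_of_mem hg
    have h₁ := hap.not_cross hT.1 hgl
    have h₂ := hap.not_cross hT.1 hgl.symm
    have h₃ := haq.not_cross hT.1 hgl
    have h₄ := haq.not_cross hT.1 hgl.symm
    have h₅ := h _ _ hgl
    have h₆ := h _ _ hgl.symm
    have h₇ : g.left = a → ¬ Clockwise p g.right q := fun h => hd _ (h ▸ hgl)
    have h₈ : g.right = a → ¬ Clockwise p g.left q := fun h => hd _ (h ▸ hgl.symm)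
    clear hd h hap haq hgl
    simp only [Finset.mem_insert, Finset.mem_singleton] at hu hv
    unfold Clockwise at *
    rcases hu with rfl | rfl | rfl | rfl <;> rcases hv with rfl | rfl | rfl | rfl <;> grind
  have hcard : ({a, p, b, q} : Finset (Fin n)).card = 4 := by
    unfold Clockwise at hp hq
    repeat rw [Finset.card_insert_of_notMem]
    · rfl
    all_goals simp only [Finset.mem_insert, Finset.mem_singleton]; omega
  obtain ⟨C, hC, hsub⟩ := exists_isCell hsep (by omega)
  have := Finset.card_le_card hsub
  have := hT.2 C hC
  omega

theorem IsTriangulation.exists_apex (hn : 3 ≤ n) {T : Finset (Chord n)}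
    (hT : IsTriangulation T) {a b : Fin n} (hab : Linked T a b) (h : ¬ IsNext a b) :
    ∃ p, Clockwise a p b ∧ Linked T a p ∧ Linked T p b := by
  obtain ⟨s, hs⟩ := exists_isNext a
  obtain ⟨p, hp, hap, -, hmax⟩ := exists_last_clockwise (Linked T a)
    (clockwise_of_isNext hab.ne hs h) (linked_of_isNext hn T hs)
  refine ⟨p, hp, hap, hT.linked_of_not_cross hn (by unfold Clockwise at hp; omega) ?_⟩
  rintro c d hcd ⟨hc, hd⟩
  have h₁ := hap.not_cross hT.1 hcd.symm
  have h₂ := hab.not_cross hT.1 hcd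
  have h₃ : d ≠ a := by rintro rfl; exact hmax c hcd.symm hc
  unfold Clockwise at *
  omega

theorem IsTriangulation.exists_triangle_of_not_linked (hn : 3 ≤ n) {T : Finset (Chord n)}
    (hT : IsTriangulation T) {a b : Fin n} (hab : a ≠ b) (h : ¬ Linked T a b) :
    ∃ p q, Clockwise a p b ∧ Clockwise b q a ∧ Linked T a p ∧ Linked T a q ∧ Linked T p q := by
  obtain ⟨p, q, hp, hq, hap, haq, hd⟩ := exists_neighbors hn T hab h
  refine ⟨p, q, hp, hq, hap, haq, hT.linked_of_not_cross hn (by unfold Clockwise at hp hq; omega) ?_⟩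
  rintro c d hcd ⟨hc, hd'⟩
  have h₁ := hap.not_cross hT.1 hcd.symm
  have h₂ := haq.not_cross hT.1 hcd
  have h₃ : d ≠ a := by rintro rfl; exact hd c hcd.symm hc
  unfold Clockwise at *
  omega

theorem IsTriangulation.exists_flip (hn : 3 ≤ n) {T : Finset (Chord n)} (hT : IsTriangulation T)
    {e : Chord n} (he : e ∈ T) :
    ∃ f : Chord n, f.Cross e ∧ ∀ g ∈ T, g ≠ e → ¬ f.Cross g := by
  have hint := hT.1.internal e he
  have hl := linked_of_mem he
  obtain ⟨p, hp, hlp, hpr⟩ := hT.exists_apex hn hl (by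
    unfold IsNext; unfold Chord.IsBoundary at hint; have := e.left_lt_right; omega)
  obtain ⟨q, hq, hrq, hql⟩ := hT.exists_apex hn hl.symm (by
    unfold IsNext; unfold Chord.IsBoundary at hint; have := e.left_lt_right; omega)
  obtain ⟨f, hf⟩ : ∃ f : Chord n, f.Joins p q :=
    exists_joins (by unfold Clockwise at hp hq; omega)
  refine ⟨f, ?_, fun g hg hge hfg => hge ?_⟩
  · rw [hf.cross_iff e.joins_self]
    unfold Clockwise at *
    omega
  · rw [hf.cross_iff g.joins_self] at hfg
    have hgl := linked_of_mem hg
    have h₁ := hlp.not_cross hT.1 hgl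
    have h₂ := hpr.not_cross hT.1 hgl
    have h₃ := hrq.not_cross hT.1 hgl
    have h₄ := hql.not_cross hT.1 hgl
    have h₅ := hlp.not_cross hT.1 hgl.symm
    have h₆ := hpr.not_cross hT.1 hgl.symm
    have h₇ := hrq.not_cross hT.1 hgl.symm
    have h₈ := hql.not_cross hT.1 hgl.symm
    have h₉ := g.left_lt_right
    have h₀ := e.left_lt_right
    have : g.left = e.left ∧ g.right = e.right := by
      clear hlp hpr hrq hql hgl hf hint hl hg hge he
      unfold Clockwise at *
      rcases hfg with hfg | hfg <;> grind
    exact Chord.ext_ends this.1 this.2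

/-! ### Turns of solid diagonals along hollow dissections -/

/-- The hollow vertex `a` lies between the solid vertices `f.left` and `f.right`; the solid diagonal
`f` separates the hollow vertices with this property from the others. -/
def Chord.Side (f : SolidDiagonal n) (a : Fin n) : Prop := f.left < a ∧ a ≤ f.right

theorem mixedCross_iff (e : HollowDiagonal n) (f : SolidDiagonal n) :
    MixedCross e f ↔ ¬ (f.Side e.left ↔ f.Side e.right) := by
  have h₁ := e.left_lt_right
  have h₂ := f.left_lt_right
  unfold MixedCross Interlace Chord.Side
  omega

theorem Chord.Joins.mixedCross_iff {e : HollowDiagonal n} {f : SolidDiagonal n} {a b : Fin n}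
    (h : e.Joins a b) : MixedCross e f ↔ ¬ (f.Side a ↔ f.Side b) := by
  rw [Accordion.mixedCross_iff]
  rcases h with ⟨rfl, rfl⟩ | ⟨rfl, rfl⟩ <;> tauto

/-- The two sides of `f` are arcs of the circle, so they cannot alternate along four points in
cyclic order. -/
theorem Chord.side_iff_of_clockwise (f : SolidDiagonal n) {a b c d : Fin n} (h : Clockwise a b c)
    (h' : Clockwise c d a) (hac : f.Side a ↔ f.Side c) (hbd : f.Side b ↔ f.Side d) :
    f.Side a ↔ f.Side b := by
  have := f.left_lt_right
  unfold Chord.Side Clockwise at *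
  omega

/-- On the clockwise arc from `s` to `s'`, the diagonal `f` crosses a segment with end `s'`. -/
def TurnsAtEnd (D : Finset (HollowDiagonal n)) (f : SolidDiagonal n) (s s' : Fin n) : Prop :=
  ∃ t, Clockwise s t s' ∧ Linked D s' t ∧ ¬ (f.Side t ↔ f.Side s')

/-- On the clockwise arc from `s` to `s'`, the diagonal `f` crosses a segment with end `s`. -/
def TurnsAtStart (D : Finset (HollowDiagonal n)) (f : SolidDiagonal n) (s s' : Fin n) : Prop :=
  ∃ t, Clockwise s t s' ∧ Linked D s t ∧ ¬ (f.Side t ↔ f.Side s)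

theorem TurnsAtEnd.mono {D T : Finset (HollowDiagonal n)} (hDT : D ⊆ T) {f : SolidDiagonal n}
    {s s' : Fin n} (h : TurnsAtEnd D f s s') : TurnsAtEnd T f s s' :=
  h.imp fun _ h => ⟨h.1, h.2.1.mono hDT, h.2.2⟩

theorem TurnsAtStart.mono {D T : Finset (HollowDiagonal n)} (hDT : D ⊆ T) {f : SolidDiagonal n}
    {s s' : Fin n} (h : TurnsAtStart D f s s') : TurnsAtStart T f s s' :=
  h.imp fun _ h => ⟨h.1, h.2.1.mono hDT, h.2.2⟩

/-- The two segments witnessing the turns do not cross, which fixes the cyclic order of the four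
endpoints; along it the sides of `f` would alternate. -/
theorem TurnsAtEnd.not_turnsAtStart {D : Finset (HollowDiagonal n)} (hD : IsDissection D)
    {f : SolidDiagonal n} {s s' : Fin n} (hs : ¬ (f.Side s ↔ f.Side s'))
    (h : TurnsAtEnd D f s s') : ¬ TurnsAtStart D f s s' := by
  obtain ⟨t, ht, hl, hf⟩ := h
  rintro ⟨t', ht', hl', hf'⟩
  have h₁ := hl'.not_cross hD hl.symm
  have h₂ : t ≠ t' := by rintro rfl; tauto
  have h₃ := f.side_iff_of_clockwise (a := s) (b := t') (c := t) (d := s')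
    (by unfold Clockwise at *; omega) (by unfold Clockwise at *; omega) (by tauto) (by tauto)
  tauto

/-- The diagonal `f` crosses `e` along a Z. -/
def CrossesZ (D : Finset (HollowDiagonal n)) (e : HollowDiagonal n) (f : SolidDiagonal n) : Prop :=
  MixedCross e f ∧ TurnsAtEnd D f e.left e.right ∧ TurnsAtEnd D f e.right e.left

/-- The diagonal `f` crosses `e` along an S. -/
def CrossesS (D : Finset (HollowDiagonal n)) (e : HollowDiagonal n) (f : SolidDiagonal n) : Prop :=
  MixedCross e f ∧ TurnsAtStart D f e.left e.right ∧ TurnsAtStart D f e.right e.left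

theorem CrossesZ.not_crossesS {D : Finset (HollowDiagonal n)} (hD : IsDissection D)
    {e : HollowDiagonal n} {f : SolidDiagonal n} (h : CrossesZ D e f) : ¬ CrossesS D e f :=
  fun h' => h.2.1.not_turnsAtStart hD ((mixedCross_iff e f).1 h.1) h'.2.1

/-- Replacing `t` by the last neighbour of `u` before `v` puts the three vertices in one cell. It
stays across `f` from `u`, since otherwise the sides would alternate along `u`, `t`, `t'`, `v`. -/
theorem exists_cell_start {D : Finset (HollowDiagonal n)} (hD : IsDissection D)
    {f : SolidDiagonal n} {u v t : Fin n} (huv : Linked D u v) (ht : Clockwise u t v)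
    (hut : Linked D u t) (hu : ¬ (f.Side u ↔ f.Side v)) (hf : ¬ (f.Side t ↔ f.Side u)) :
    ∃ t', Clockwise u t' v ∧ Linked D u t' ∧ ¬ (f.Side t' ↔ f.Side u) ∧
      ∃ C, IsCell D C ∧ u ∈ C ∧ v ∈ C ∧ t' ∈ C := by
  obtain ⟨p, hp, hup, hpt, hmax⟩ := exists_last_clockwise (Linked D u) ht hut
  refine ⟨p, hp, hup, ?_, ?_⟩
  · rcases hpt with rfl | hpt
    · exact hf
    · intro h
      have := f.side_iff_of_clockwise (a := u) (b := t) (c := p) (d := v) hpt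
        (by unfold Clockwise at *; omega) h.symm (by tauto)
      tauto
  · have hsep : NotSeparated D {u, v, p} := by
      rw [notSeparated_iff]
      intro g hg x hx y hy hxy
      have hgl := linked_of_mem hg
      have h₁ := huv.not_cross hD hgl
      have h₂ := huv.not_cross hD hgl.symm
      have h₃ := hup.not_cross hD hgl
      have h₄ := hup.not_cross hD hgl.symm
      have h₇ : g.left = u → ¬ Clockwise p g.right v := fun h => hmax _ (h ▸ hgl)
      have h₈ : g.right = u → ¬ Clockwise p g.left v := fun h => hmax _ (h ▸ hgl.symm)
      clear hmax huv hup hgl hf hu hpt hut ht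
      simp only [Finset.mem_insert, Finset.mem_singleton] at hx hy
      unfold Clockwise at *
      rcases hx with rfl | rfl | rfl <;> rcases hy with rfl | rfl | rfl <;> grind
    obtain ⟨C, hC, hsub⟩ := exists_isCell hsep (by
      unfold Clockwise at hp
      repeat rw [Finset.card_insert_of_notMem]
      · rfl
      all_goals simp only [Finset.mem_insert, Finset.mem_singleton]; omega)
    exact ⟨C, hC, hsub (by simp), hsub (by simp), hsub (by simp)⟩

theorem exists_cell_end {D : Finset (HollowDiagonal n)} (hD : IsDissection D)
    {f : SolidDiagonal n} {u v t : Fin n} (huv : Linked D u v) (ht : Clockwise v t u)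
    (hut : Linked D u t) (hu : ¬ (f.Side u ↔ f.Side v)) (hf : ¬ (f.Side t ↔ f.Side u)) :
    ∃ t', Clockwise v t' u ∧ Linked D u t' ∧ ¬ (f.Side t' ↔ f.Side u) ∧
      ∃ C, IsCell D C ∧ u ∈ C ∧ v ∈ C ∧ t' ∈ C := by
  obtain ⟨p, hp, hup, hpt, hmax⟩ := exists_first_clockwise (Linked D u) ht hut
  refine ⟨p, hp, hup, ?_, ?_⟩
  · rcases hpt with rfl | hpt
    · exact hf
    · intro h
      have := f.side_iff_of_clockwise (a := u) (b := v) (c := p) (d := t)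
        (by unfold Clockwise at *; omega) hpt h.symm (by tauto)
      tauto
  · have hsep : NotSeparated D {u, v, p} := by
      rw [notSeparated_iff]
      intro g hg x hx y hy hxy
      have hgl := linked_of_mem hg
      have h₁ := huv.not_cross hD hgl
      have h₂ := huv.not_cross hD hgl.symm
      have h₃ := hup.not_cross hD hgl
      have h₄ := hup.not_cross hD hgl.symm
      have h₇ : g.left = u → ¬ Clockwise v g.right p := fun h => hmax _ (h ▸ hgl)
      have h₈ : g.right = u → ¬ Clockwise v g.left p := fun h => hmax _ (h ▸ hgl.symm)
      clear hmax huv hup hgl hf hu hpt hut ht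
      simp only [Finset.mem_insert, Finset.mem_singleton] at hx hy
      unfold Clockwise at *
      rcases hx with rfl | rfl | rfl <;> rcases hy with rfl | rfl | rfl <;> grind
    obtain ⟨C, hC, hsub⟩ := exists_isCell hsep (by
      unfold Clockwise at hp
      repeat rw [Finset.card_insert_of_notMem]
      · rfl
      all_goals simp only [Finset.mem_insert, Finset.mem_singleton]; omega)
    exact ⟨C, hC, hsub (by simp), hsub (by simp), hsub (by simp)⟩

theorem Chord.Joins.ends_mem {e : Chord n} {a b : Fin n} (h : e.Joins a b) {C : Finset (Fin n)}
    (ha : a ∈ C) (hb : b ∈ C) : e.left ∈ C ∧ e.right ∈ C := by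
  rcases h with ⟨rfl, rfl⟩ | ⟨rfl, rfl⟩ <;> exact ⟨by assumption, by assumption⟩

theorem slaloms_of_cells {D : Finset (HollowDiagonal n)} {e : HollowDiagonal n}
    {f : SolidDiagonal n} (he : e ∈ D) (hef : MixedCross e f) {t u v w : Fin n} (hj : e.Joins u v)
    (hut : Linked D u t) (hvw : Linked D v w) (ht : ¬ (f.Side t ↔ f.Side u))
    (hw : ¬ (f.Side w ↔ f.Side v))
    (hC : ∃ C, IsCell D C ∧ u ∈ C ∧ v ∈ C ∧ t ∈ C) (hC' : ∃ C, IsCell D C ∧ v ∈ C ∧ u ∈ C ∧ w ∈ C)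
    (hopp : (Clockwise u t v ∧ Clockwise v w u) ∨ (Clockwise v t u ∧ Clockwise u w v)) :
    Slaloms D e f t u v w := by
  obtain ⟨C, hC, huC, hvC, htC⟩ := hC
  obtain ⟨C', hC', hvC', huC', hwC'⟩ := hC'
  obtain ⟨μ, hμ, hμ'⟩ := hut.symm
  obtain ⟨ν, hν, hν'⟩ := hvw
  refine ⟨hef, μ, ⟨hμ, hμ'.mixedCross_iff.2 ht⟩, ν, ⟨hν, hν'.mixedCross_iff.2 (by tauto)⟩, ?_, ?_,
    ⟨C, C', hC, hC', ?_, ?_, ?_⟩, hμ', hj, hν'⟩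
  · rintro rfl
    unfold Chord.Joins Clockwise at *
    omega
  · rintro rfl
    unfold Chord.Joins Clockwise at *
    omega
  -- A common cell would contain `t` and `w`, which lie strictly on opposite sides of `e`.
  · rintro rfl
    have := notSeparated_iff.1 hC.prop.1 e he
    have h₁ := this t htC w hwC'
    have h₂ := this w hwC' t htC
    rcases hj with ⟨rfl, rfl⟩ | ⟨rfl, rfl⟩ <;> tauto
  · exact ⟨(hj.ends_mem huC hvC).1, (hj.ends_mem huC hvC).2, hμ'.ends_mem htC huC⟩
  · exact ⟨(hj.ends_mem huC' hvC').1, (hj.ends_mem huC' hvC').2, hν'.ends_mem hvC' hwC'⟩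

theorem Slaloms.turns {D : Finset (HollowDiagonal n)} {e : HollowDiagonal n} {f : SolidDiagonal n}
    {t u v w : Fin n} (h : Slaloms D e f t u v w) :
    e.Joins u v ∧ Linked D u t ∧ Linked D v w ∧ ¬ (f.Side t ↔ f.Side u) ∧
      ¬ (f.Side w ↔ f.Side v) := by
  obtain ⟨-, μ, ⟨hμ, hμf⟩, ν, ⟨hν, hνf⟩, -, -, -, hμ', hj, hν'⟩ := h
  rw [hμ'.mixedCross_iff] at hμf
  rw [hν'.mixedCross_iff] at hνf
  exact ⟨hj, Linked.symm ⟨μ, hμ, hμ'⟩, ⟨ν, hν, hν'⟩, hμf, by tauto⟩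

/-- This removes cells from the definition of the sign. Turns, unlike cells, are monotone in the
dissection, so they can be compared between `D` and `T`. -/
theorem exists_slaloms_isZ_iff {D : Finset (HollowDiagonal n)} (hD : IsDissection D)
    {e : HollowDiagonal n} (he : e ∈ D) (f : SolidDiagonal n) :
    (∃ t u v w, Slaloms D e f t u v w ∧ IsZ t u v w) ↔ CrossesZ D e f := by
  constructor
  · rintro ⟨t, u, v, w, h, hZ⟩
    obtain ⟨hj, hut, hvw, ht, hw⟩ := h.turns
    refine ⟨h.1, ?_⟩
    have h₁ : TurnsAtEnd D f u v := ⟨w, hZ.2.rotate.rotate, hvw, hw⟩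
    have h₂ : TurnsAtEnd D f v u := ⟨t, hZ.1.rotate.rotate, hut, ht⟩
    rcases hj with ⟨rfl, rfl⟩ | ⟨rfl, rfl⟩
    exacts [⟨h₁, h₂⟩, ⟨h₂, h₁⟩]
  · rintro ⟨hef, ⟨w, hw, hvw, hwf⟩, t, ht, hut, htf⟩
    have hl := linked_of_mem he
    have hs := (mixedCross_iff e f).1 hef
    obtain ⟨t, ht, hut, htf, hC⟩ := exists_cell_end hD hl ht hut hs htf
    obtain ⟨w, hw, hvw, hwf, hC'⟩ := exists_cell_end hD hl.symm hw hvw (by tauto) hwf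
    exact ⟨t, e.left, e.right, w, slaloms_of_cells he hef e.joins_self hut hvw htf hwf hC hC'
      (Or.inr ⟨ht, hw⟩), ht.rotate, hw.rotate⟩

theorem exists_slaloms_isS_iff {D : Finset (HollowDiagonal n)} (hD : IsDissection D)
    {e : HollowDiagonal n} (he : e ∈ D) (f : SolidDiagonal n) :
    (∃ t u v w, Slaloms D e f t u v w ∧ IsS t u v w) ↔ CrossesS D e f := by
  constructor
  · rintro ⟨t, u, v, w, h, hZ⟩
    obtain ⟨hj, hut, hvw, ht, hw⟩ := h.turns
    refine ⟨h.1, ?_⟩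
    have h₁ : TurnsAtStart D f u v := ⟨t, hZ.1.rotate, hut, ht⟩
    have h₂ : TurnsAtStart D f v u := ⟨w, hZ.2.rotate, hvw, hw⟩
    rcases hj with ⟨rfl, rfl⟩ | ⟨rfl, rfl⟩
    exacts [⟨h₁, h₂⟩, ⟨h₂, h₁⟩]
  · rintro ⟨hef, ⟨t, ht, hut, htf⟩, w, hw, hvw, hwf⟩
    have hl := linked_of_mem he
    have hs := (mixedCross_iff e f).1 hef
    obtain ⟨t, ht, hut, htf, hC⟩ := exists_cell_start hD hl ht hut hs htf
    obtain ⟨w, hw, hvw, hwf, hC'⟩ := exists_cell_start hD hl.symm hw hvw (by tauto) hwf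
    exact ⟨t, e.left, e.right, w, slaloms_of_cells he hef e.joins_self hut hvw htf hwf hC hC'
      (Or.inl ⟨ht, hw⟩), ht.rotate.rotate, hw.rotate.rotate⟩

open Classical in
theorem slalomSign_eq {D : Finset (HollowDiagonal n)} (hD : IsDissection D)
    {e : HollowDiagonal n} (he : e ∈ D) (f : SolidDiagonal n) :
    slalomSign D e f = if CrossesZ D e f then 1 else if CrossesS D e f then -1 else 0 := by
  unfold slalomSign
  simp only [exists_slaloms_isZ_iff hD he, exists_slaloms_isS_iff hD he]

theorem slalomSign_eq_zero_iff {D : Finset (HollowDiagonal n)} (hD : IsDissection D)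
    {e : HollowDiagonal n} (he : e ∈ D) (f : SolidDiagonal n) :
    slalomSign D e f = 0 ↔ ¬ CrossesZ D e f ∧ ¬ CrossesS D e f := by
  rw [slalomSign_eq hD he]
  split_ifs <;> simp_all

/-! ### Signs in a triangulation -/

open Classical in
/-- The number of times that `f` crosses the segment joining the hollow vertices `a` and `b`. -/
def crossing (f : SolidDiagonal n) (a b : Fin n) : ℝ := if f.Side a ↔ f.Side b then 0 else 1

theorem crossing_comm (f : SolidDiagonal n) (a b : Fin n) : crossing f a b = crossing f b a := by
  unfold crossing
  by_cases h₁ : f.Side a <;> by_cases h₂ : f.Side b <;> simp [h₁, h₂]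

theorem TurnsAtEnd.iff_apex {T : Finset (HollowDiagonal n)} (hT : IsDissection T)
    {f : SolidDiagonal n} {s s' p : Fin n} (hs : ¬ (f.Side s ↔ f.Side s')) (hp : Clockwise s p s')
    (h : Linked T s p) (h' : Linked T p s') : TurnsAtEnd T f s s' ↔ (f.Side s ↔ f.Side p) := by
  constructor
  · intro ht
    by_contra hne
    exact ht.not_turnsAtStart hT hs ⟨p, hp, h, by tauto⟩
  · intro hne
    exact ⟨p, hp, h'.symm, by tauto⟩

theorem TurnsAtStart.iff_apex {T : Finset (HollowDiagonal n)} (hT : IsDissection T)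
    {f : SolidDiagonal n} {s s' p : Fin n} (hs : ¬ (f.Side s ↔ f.Side s')) (hp : Clockwise s p s')
    (h : Linked T s p) (h' : Linked T p s') : TurnsAtStart T f s s' ↔ (f.Side s' ↔ f.Side p) := by
  constructor
  · intro ht
    by_contra hne
    exact TurnsAtEnd.not_turnsAtStart hT hs ⟨p, hp, h'.symm, by tauto⟩ ht
  · intro hne
    exact ⟨p, hp, h, by tauto⟩

theorem crossesZ_iff {T : Finset (HollowDiagonal n)} (hT : IsDissection T) {e : HollowDiagonal n}
    {f : SolidDiagonal n} {p q : Fin n} (hp : Clockwise e.left p e.right)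
    (hlp : Linked T e.left p) (hpr : Linked T p e.right) (hq : Clockwise e.right q e.left)
    (hrq : Linked T e.right q) (hql : Linked T q e.left) :
    CrossesZ T e f ↔ (f.Side e.left ↔ f.Side p) ∧ (f.Side e.right ↔ f.Side q) ∧
      ¬ (f.Side e.left ↔ f.Side e.right) := by
  rw [CrossesZ, mixedCross_iff]
  by_cases h : f.Side e.left ↔ f.Side e.right
  · tauto
  · rw [TurnsAtEnd.iff_apex hT h hp hlp hpr, TurnsAtEnd.iff_apex hT (by tauto) hq hrq hql]
    tauto

theorem crossesS_iff {T : Finset (HollowDiagonal n)} (hT : IsDissection T) {e : HollowDiagonal n}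
    {f : SolidDiagonal n} {p q : Fin n} (hp : Clockwise e.left p e.right)
    (hlp : Linked T e.left p) (hpr : Linked T p e.right) (hq : Clockwise e.right q e.left)
    (hrq : Linked T e.right q) (hql : Linked T q e.left) :
    CrossesS T e f ↔ (f.Side e.right ↔ f.Side p) ∧ (f.Side e.left ↔ f.Side q) ∧
      ¬ (f.Side e.left ↔ f.Side e.right) := by
  rw [CrossesS, mixedCross_iff]
  by_cases h : f.Side e.left ↔ f.Side e.right
  · tauto
  · rw [TurnsAtStart.iff_apex hT h hp hlp hpr, TurnsAtStart.iff_apex hT (by tauto) hq hrq hql]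
    tauto

theorem IsTriangulation.exists_apexes (hn : 3 ≤ n) {T : Finset (Chord n)} (hT : IsTriangulation T)
    {e : Chord n} (he : e ∈ T) : ∃ p q, Clockwise e.left p e.right ∧ Linked T e.left p ∧
      Linked T p e.right ∧ Clockwise e.right q e.left ∧ Linked T e.right q ∧ Linked T q e.left := by
  have hint := hT.1.internal e he
  have hl := linked_of_mem he
  obtain ⟨p, hp⟩ := hT.exists_apex hn hl (by
    unfold IsNext; unfold Chord.IsBoundary at hint; have := e.left_lt_right; omega)
  obtain ⟨q, hq⟩ := hT.exists_apex hn hl.symm (by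
    unfold IsNext; unfold Chord.IsBoundary at hint; have := e.left_lt_right; omega)
  exact ⟨p, q, hp.1, hp.2.1, hp.2.2, hq⟩

/-- The sign is a shear coordinate of the quadrilateral around `e`. It becomes linear in crossing
numbers, which makes both the exchange relation and the uniqueness argument possible. -/
theorem slalomSign_eq_crossing {T : Finset (HollowDiagonal n)} (hT : IsDissection T)
    {e : HollowDiagonal n} (he : e ∈ T) {p q : Fin n} (hp : Clockwise e.left p e.right)
    (hlp : Linked T e.left p) (hpr : Linked T p e.right) (hq : Clockwise e.right q e.left)
    (hrq : Linked T e.right q) (hql : Linked T q e.left) (f : SolidDiagonal n) :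
    2 * slalomSign T e f = crossing f e.left q + crossing f p e.right - crossing f e.left p
      - crossing f e.right q := by
  rw [slalomSign_eq hT he, crossesZ_iff hT hp hlp hpr hq hrq hql,
    crossesS_iff hT hp hlp hpr hq hrq hql]
  have := f.side_iff_of_clockwise hp hq
  unfold crossing
  by_cases h₁ : f.Side e.left <;> by_cases h₂ : f.Side e.right <;> by_cases h₃ : f.Side p <;>
    by_cases h₄ : f.Side q <;> simp_all <;> norm_num

/-! ### Accordion diagonals and signs -/

theorem exists_isNext_side (f : SolidDiagonal n) {s s' : Fin n}
    (hs : ¬ (f.Side s ↔ f.Side s')) : ∃ a b, IsNext a b ∧ ¬ (f.Side a ↔ f.Side b) ∧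
      ¬ Clockwise s' a s ∧ ¬ Clockwise s' b s := by
  have hf := f.left_lt_right
  by_cases h : f.Side s
  · obtain ⟨b, hb⟩ := exists_isNext f.right
    refine ⟨f.right, b, hb, ?_⟩
    unfold Chord.Side IsNext Clockwise at *
    omega
  · obtain ⟨b, hb⟩ := exists_isNext f.left
    refine ⟨f.left, b, hb, ?_⟩
    unfold Chord.Side IsNext Clockwise at *
    omega

theorem Chord.IsEndpoint.exists_joins {e : Chord n} {a : Fin n} (h : e.IsEndpoint a) :
    ∃ b, e.Joins a b := by
  rcases h with rfl | rfl
  exacts [⟨e.right, Or.inl ⟨rfl, rfl⟩⟩, ⟨e.left, Or.inr ⟨rfl, rfl⟩⟩]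

theorem Chord.Joins.isEndpoint {e : Chord n} {a b : Fin n} (h : e.Joins a b) :
    e.IsEndpoint a ∧ e.IsEndpoint b := by
  rcases h with ⟨rfl, rfl⟩ | ⟨rfl, rfl⟩
  exacts [⟨Or.inl rfl, Or.inr rfl⟩, ⟨Or.inr rfl, Or.inl rfl⟩]

theorem Chord.Joins.ne {e : Chord n} {a b : Fin n} (h : e.Joins a b) : a ≠ b := by
  have := e.left_lt_right
  unfold Chord.Joins at h
  omega

theorem Chord.Joins.right_unique {e : Chord n} {a b c : Fin n} (h : e.Joins a b)
    (h' : e.Joins a c) : b = c := by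
  have := e.left_lt_right
  unfold Chord.Joins at h h'
  omega

theorem clockwise_of_not_clockwise {s s' z w : Fin n} (hs : s ≠ s') (hz : z = s ∨ z = s')
    (hw : w ≠ z) (h₁ : w = s → z ≠ s') (h₂ : w = s' → z ≠ s) (h : ¬ Clockwise s' w s) :
    Clockwise s w s' := by
  unfold Clockwise at *
  omega

theorem eq_or_eq_of_not_cross {s s' z w : Fin n}
    (h : ¬ ((Clockwise s z s' ∧ Clockwise s' w s) ∨ (Clockwise s w s' ∧ Clockwise s' z s)))
    (hz : ¬ Clockwise s' z s) (hw : Clockwise s' w s) : z = s ∨ z = s' := by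
  unfold Clockwise at *
  omega

theorem Chord.Joins.eq_or_eq_of_isEndpoint {e : Chord n} {a b c : Fin n} (h : e.Joins a b)
    (hc : e.IsEndpoint c) : c = a ∨ c = b := by
  unfold Chord.Joins at h
  unfold Chord.IsEndpoint at hc
  omega

/-- Connectedness gives a chain of crossed segments, consecutive ones sharing an endpoint, from one
boundary edge crossed by `f` to the other, on opposite sides of `e`. Where the chain passes `e`, it
either lands on `e` itself, or jumps over `e` through an endpoint of `e`, at which `f` then turns on
both sides. -/
theorem IsAccordionDiagonal.turns (hn : 3 ≤ n) {D : Finset (HollowDiagonal n)}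
    {f : SolidDiagonal n} (hf : IsAccordionDiagonal D f) {e : HollowDiagonal n}
    (hint : ¬ e.IsBoundary) (hcross : ∀ g ∈ D, ¬ e.Cross g) {s s' : Fin n} (he : e.Joins s s')
    (hef : MixedCross e f) :
    (TurnsAtEnd D f s s' ∧ (e ∈ D ∨ TurnsAtStart D f s' s)) ∨
      (TurnsAtStart D f s s' ∧ (e ∈ D ∨ TurnsAtEnd D f s' s)) := by
  have hs := he.mixedCross_iff.1 hef
  have hcross' : ∀ g ∈ withBoundary D, ¬ e.Cross g := by
    rintro g (hg | hg)
    · exact hcross g hg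
    · rw [Chord.cross_comm]; exact hg.not_cross e
  obtain ⟨a, b, hab, habf, ha, hb⟩ := exists_isNext_side f hs
  obtain ⟨c, d, hcd, hcdf, hc, hd⟩ := exists_isNext_side f (s := s') (s' := s) fun h => hs h.symm
  obtain ⟨g₀, hg₀, hg₀'⟩ := linked_of_isNext hn ∅ hab
  obtain ⟨g₁, hg₁, hg₁'⟩ := linked_of_isNext hn ∅ hcd
  replace hg₀ : g₀.IsBoundary := by simpa [withBoundary] using hg₀
  replace hg₁ : g₁.IsBoundary := by simpa [withBoundary] using hg₁
  -- The crossed segments other than `e` that lie on the closed arc from `s` to `s'`; a walk between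
  -- the two boundary edges must leave this set.
  let Q : Set (crossed D f) := {g | g.1 ≠ e ∧ ∀ v, g.1.IsEndpoint v → ¬ Clockwise s' v s}
  have h₀ : (⟨g₀, Or.inr hg₀, hg₀'.mixedCross_iff.2 habf⟩ : crossed D f) ∈ Q := by
    refine ⟨fun h => hint (h ▸ hg₀), fun v hv => ?_⟩
    rcases hg₀'.eq_or_eq_of_isEndpoint hv with rfl | rfl
    exacts [ha, hb]
  have h₁ : (⟨g₁, Or.inr hg₁, hg₁'.mixedCross_iff.2 hcdf⟩ : crossed D f) ∉ Q := by
    rintro ⟨h, hv⟩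
    have h₁ := hv c hg₁'.isEndpoint.1
    have h₂ := hv d hg₁'.isEndpoint.2
    have h₃ := hg₁'.ne
    have h₄ := he.ne
    have : (c = s ∧ d = s') ∨ (c = s' ∧ d = s) := by
      unfold Clockwise at *
      omega
    rcases this with ⟨rfl, rfl⟩ | ⟨rfl, rfl⟩
    exacts [h (hg₁'.eq he), h (hg₁'.symm.eq he)]
  obtain ⟨p⟩ := hf.preconnected ⟨g₀, Or.inr hg₀, hg₀'.mixedCross_iff.2 habf⟩
    ⟨g₁, Or.inr hg₁, hg₁'.mixedCross_iff.2 hcdf⟩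
  obtain ⟨⟨⟨⟨g, hgD, hgf⟩, g', hg'D, hg'f⟩, hadj⟩, -, ⟨hge, hgQ⟩, hg'⟩ :=
    p.exists_boundary_dart Q h₀ h₁
  simp only at hge hgQ hg'
  obtain ⟨-, z, hz, hz'⟩ := hadj
  simp only [Function.Embedding.subtype_apply] at hz hz'
  obtain ⟨w, hw⟩ := hz.exists_joins
  obtain ⟨w', hw'⟩ := hz'.exists_joins
  have hwf := hw.mixedCross_iff.1 hgf
  have hwf' := hw'.mixedCross_iff.1 hg'f
  have hzQ := hgQ z hz
  have hwQ := hgQ w hw.isEndpoint.2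
  have hne : ∀ {x}, (x = e → False) → ¬ (x.Joins s s') := fun h h' => h (h'.eq he)
  have key : (z = s ∨ z = s') → Clockwise s w s' := by
    intro hzs
    have h₁ := hne hge
    have h₂ := hw.ne
    refine clockwise_of_not_clockwise he.ne hzs h₂.symm (fun h h' => h₁ ?_) (fun h h' => h₁ ?_) hwQ
    · exact h' ▸ h ▸ hw.symm
    · exact h' ▸ h ▸ hw
  by_cases hg'e : g' = e
  · have heD : e ∈ D := by
      subst hg'e
      exact hg'D.resolve_right hint
    have hzs : z = s ∨ z = s' := by
      subst hg'e
      unfold Chord.IsEndpoint at hz'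
      unfold Chord.Joins at he
      omega
    rcases hzs with rfl | rfl
    · exact Or.inr ⟨⟨w, key (Or.inl rfl), ⟨g, hgD, hw⟩, fun h => hwf h.symm⟩, Or.inl heD⟩
    · exact Or.inl ⟨⟨w, key (Or.inr rfl), ⟨g, hgD, hw⟩, fun h => hwf h.symm⟩, Or.inl heD⟩
  · have h₁ : Clockwise s' z s ∨ Clockwise s' w' s := by
      by_contra! hcon
      refine hg' ⟨hg'e, fun v hv => ?_⟩
      rcases hw'.eq_or_eq_of_isEndpoint hv with rfl | rfl
      exacts [hcon.1, hcon.2]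
    have h₂ := hcross' g' hg'D
    rw [he.cross_iff hw'] at h₂
    have h₄ : Clockwise s' w' s := h₁.resolve_left hzQ
    have hzs := eq_or_eq_of_not_cross h₂ hzQ h₄
    rcases hzs with rfl | rfl
    · exact Or.inr ⟨⟨w, key (Or.inl rfl), ⟨g, hgD, hw⟩, fun h => hwf h.symm⟩,
        Or.inr ⟨w', h₄, ⟨g', hg'D, hw'⟩, fun h => hwf' h.symm⟩⟩
    · exact Or.inl ⟨⟨w, key (Or.inr rfl), ⟨g, hgD, hw⟩, fun h => hwf h.symm⟩,
        Or.inr ⟨w', h₄, ⟨g', hg'D, hw'⟩, fun h => hwf' h.symm⟩⟩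

/-- As `e` is not in `D`, the chain must jump over it: `f` turns around the same endpoint on both
sides, a V, and this excludes both a Z and an S. -/
theorem IsAccordionDiagonal.slalomSign_eq_zero (hn : 3 ≤ n) {D T : Finset (HollowDiagonal n)}
    (hT : IsDissection T) (hDT : D ⊆ T) {f : SolidDiagonal n} (hf : IsAccordionDiagonal D f)
    {e : HollowDiagonal n} (heT : e ∈ T) (heD : e ∉ D) : slalomSign T e f = 0 := by
  rw [slalomSign_eq_zero_iff hT heT]
  by_cases hef : MixedCross e f
  · have hs := (mixedCross_iff e f).1 hef
    rcases hf.turns hn (hT.internal e heT) (fun g hg => hT.nonCrossing e heT g (hDT hg))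
      e.joins_self hef with ⟨h₁, h₂⟩ | ⟨h₁, h₂⟩
    · have h₂ := h₂.resolve_left heD
      exact ⟨fun h => h.2.2.not_turnsAtStart hT (by tauto) (h₂.mono hDT),
        fun h => (h₁.mono hDT).not_turnsAtStart hT hs h.2.1⟩
    · have h₂ := h₂.resolve_left heD
      exact ⟨fun h => h.2.1.not_turnsAtStart hT hs (h₁.mono hDT),
        fun h => (h₂.mono hDT).not_turnsAtStart hT (by tauto) h.2.2⟩
  · exact ⟨fun h => hef h.1, fun h => hef h.1⟩

/-- In `D` the diagonal already makes one of the two turns on this arc. The turn persists in `T`,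
where the two are incompatible. -/
theorem IsAccordionDiagonal.turnsAtEnd_iff (hn : 3 ≤ n) {D T : Finset (HollowDiagonal n)}
    (hT : IsDissection T) (hDT : D ⊆ T) {f : SolidDiagonal n} (hf : IsAccordionDiagonal D f)
    {e : HollowDiagonal n} (he : e ∈ D) {s s' : Fin n} (hj : e.Joins s s') (hef : MixedCross e f) :
    (TurnsAtEnd T f s s' ↔ TurnsAtEnd D f s s') ∧
      (TurnsAtStart T f s s' ↔ TurnsAtStart D f s s') := by
  have hs := hj.mixedCross_iff.1 hef
  have h₀ := hf.turns hn (hT.internal e (hDT he))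
    (fun g hg => hT.nonCrossing e (hDT he) g (hDT hg)) hj hef
  refine ⟨⟨fun h => ?_, fun h => h.mono hDT⟩, ⟨fun h => ?_, fun h => h.mono hDT⟩⟩ <;>
    rcases h₀ with h' | h'
  · exact h'.1
  · exact absurd (h'.1.mono hDT) (h.not_turnsAtStart hT hs)
  · exact absurd h ((h'.1.mono hDT).not_turnsAtStart hT hs)
  · exact h'.1

theorem IsDissection.subset {D T : Finset (Chord n)} (hT : IsDissection T) (hDT : D ⊆ T) :
    IsDissection D :=
  ⟨fun e he => hT.internal e (hDT he), fun e he f hf => hT.nonCrossing e (hDT he) f (hDT hf)⟩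

theorem IsAccordionDiagonal.slalomSign_eq (hn : 3 ≤ n) {D T : Finset (HollowDiagonal n)}
    (hT : IsDissection T) (hDT : D ⊆ T) {f : SolidDiagonal n} (hf : IsAccordionDiagonal D f)
    {e : HollowDiagonal n} (he : e ∈ D) : slalomSign T e f = slalomSign D e f := by
  have hZ : CrossesZ T e f ↔ CrossesZ D e f := and_congr_right fun h => and_congr
    (hf.turnsAtEnd_iff hn hT hDT he e.joins_self h).1
    (hf.turnsAtEnd_iff hn hT hDT he e.joins_self.symm h).1
  have hS : CrossesS T e f ↔ CrossesS D e f := and_congr_right fun h => and_congr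
    (hf.turnsAtEnd_iff hn hT hDT he e.joins_self h).2
    (hf.turnsAtEnd_iff hn hT hDT he e.joins_self.symm h).2
  rw [Accordion.slalomSign_eq hT (hDT he), Accordion.slalomSign_eq (hT.subset hDT) he]
  classical exact if_congr hZ rfl (if_congr hS rfl rfl)

/-- The sides on which `f` makes its turns determine the sign of `f`. -/
theorem slalomSign_ne_zero {D : Finset (HollowDiagonal n)} (hD : IsDissection D)
    {e : HollowDiagonal n} (he : e ∈ D) {f : SolidDiagonal n} {s s' : Fin n} (hj : e.Joins s s')
    (hs : ¬ (f.Side s ↔ f.Side s'))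
    (h : (TurnsAtEnd D f s s' ∧ TurnsAtEnd D f s' s) ∨
      (TurnsAtStart D f s s' ∧ TurnsAtStart D f s' s)) : slalomSign D e f ≠ 0 := by
  have hef := hj.mixedCross_iff.2 hs
  rw [Ne, slalomSign_eq_zero_iff hD he, CrossesZ, CrossesS]
  rcases hj with ⟨rfl, rfl⟩ | ⟨rfl, rfl⟩ <;> tauto

/-- A diagonal that crosses no diagonal of `T ∖ D` along a Z or an S passes from one segment of
`D` to the next through a common endpoint. -/
theorem exists_previous_crossed (hn : 3 ≤ n) {D T : Finset (HollowDiagonal n)}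
    (hT : IsTriangulation T) {f : SolidDiagonal n}
    (hf : ∀ e ∈ T, e ∉ D → slalomSign T e f = 0) {s s' : Fin n} (hl : Linked T s s')
    (hs : ¬ f.Side s) (hs' : f.Side s') (hnext : ¬ IsNext s s') :
    ∃ t, Clockwise s t s' ∧ ((f.Side t ∧ Linked D s t) ∨ (¬ f.Side t ∧ Linked D t s')) := by
  have hss : ¬ (f.Side s ↔ f.Side s') := by tauto
  have hDl : ∀ {a b}, Linked T a b → ¬ Linked D a b → ∃ e ∈ T, e.Joins a b ∧ e ∉ D := by
    rintro a b ⟨e, he | he, hj⟩ h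
    · exact ⟨e, he, hj, fun h' => h ⟨e, Or.inl h', hj⟩⟩
    · exact absurd ⟨e, Or.inr he, hj⟩ h
  obtain ⟨p, hp, hsp, hps⟩ := hT.exists_apex hn hl hnext
  by_cases hpf : f.Side p
  -- Here `f` pivots around `s`, and `st` is the last segment of `T` at `s` that it crosses. Beyond
  -- it `f` turns at `t`, while on the side of `s'` it turns at `s`: this is a Z, so `st` cannot be
  -- in `T` outside `D`.
  · obtain ⟨t, ht, ⟨hst, htf⟩, -, hmin⟩ := exists_first_clockwise
      (fun t => Linked T s t ∧ f.Side t) hp ⟨hsp, hpf⟩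
    refine ⟨t, ht, Or.inl ⟨htf, ?_⟩⟩
    by_contra hD
    obtain ⟨e, heT, hj, heD⟩ := hDl hst hD
    refine slalomSign_ne_zero hT.1 heT hj (by tauto) (Or.inl ⟨?_, s', ?_, hl, by tauto⟩)
      (hf e heT heD)
    · obtain ⟨q, hq, hsq, hqt⟩ := hT.exists_apex hn hst
        (fun h => hD (linked_of_isNext hn D h))
      refine ⟨q, hq, hqt.symm, fun h => hmin q ⟨hsq, h.2 htf⟩ hq⟩
    · exact ht.rotate
  · obtain ⟨t, ht, ⟨hst, htf⟩, -, hmin⟩ := exists_last_clockwise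
      (fun t => Linked T t s' ∧ ¬ f.Side t) hp ⟨hps, hpf⟩
    refine ⟨t, ht, Or.inr ⟨htf, ?_⟩⟩
    by_contra hD
    obtain ⟨e, heT, hj, heD⟩ := hDl hst hD
    refine slalomSign_ne_zero hT.1 heT hj (by tauto) (Or.inr ⟨?_, s, ?_, hl.symm, by tauto⟩)
      (hf e heT heD)
    · obtain ⟨q, hq, htq, hqs⟩ := hT.exists_apex hn hst
        (fun h => hD (linked_of_isNext hn D h))
      refine ⟨q, hq, htq, fun h => hmin q ⟨hqs, by tauto⟩ hq⟩
    · exact ht.rotate.rotate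

/-- Starting from any crossed segment, `exists_previous_crossed` steps to an adjacent one spanning a
shorter arc, until the boundary edge at `f.left` is reached. -/
theorem isAccordionDiagonal_of_slalomSign (hn : 3 ≤ n) {D T : Finset (HollowDiagonal n)}
    (hT : IsTriangulation T) (hDT : D ⊆ T) {f : SolidDiagonal n}
    (hf : ∀ e ∈ T, e ∉ D → slalomSign T e f = 0) : IsAccordionDiagonal D f := by
  have hf' := f.left_lt_right
  obtain ⟨b, hb⟩ := exists_isNext f.left
  obtain ⟨g₀, hg₀, hg₀'⟩ := linked_of_isNext hn D hb
  have hbf : f.Side b ∧ ¬ f.Side f.left := by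
    unfold Chord.Side IsNext at *
    omega
  let root : crossed D f := ⟨g₀, hg₀, hg₀'.mixedCross_iff.2 (by tauto)⟩
  have key : ∀ m s s', arcLength s s' = m → ¬ f.Side s → f.Side s' → ∀ e : crossed D f,
      e.1.Joins s s' → ((incidenceGraph n).induce (crossed D f)).Reachable root e := by
    intro m
    induction m using Nat.strong_induction_on with
    | _ m ih =>
      rintro s s' rfl hs hs' ⟨e, heD, hef⟩ hj
      by_cases hnext : IsNext s s'
      · have hsl : s = f.left := by unfold Chord.Side IsNext at *; omega
        have hsb : s' = b := by unfold IsNext at *; omega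
        subst hsl hsb
        have : e = g₀ := hj.eq hg₀'
        subst this
        exact SimpleGraph.Reachable.refl _
      · obtain ⟨t, ht, ⟨htf, g, hg, hgj⟩ | ⟨htf, g, hg, hgj⟩⟩ := exists_previous_crossed hn hT hf
          (Linked.mono hDT ⟨e, heD, hj⟩) hs hs' hnext
        · refine (ih _ (arcLength_lt_of_clockwise ht) s t rfl hs htf
            ⟨g, hg, hgj.mixedCross_iff.2 (by tauto)⟩ hgj).trans (SimpleGraph.Adj.reachable ?_)
          refine ⟨?_, s, hgj.isEndpoint.1, hj.isEndpoint.1⟩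
          intro h
          replace h : g = e := h
          have := (h ▸ hgj).right_unique hj
          unfold Clockwise at ht
          omega
        · refine (ih _ (arcLength_lt_of_clockwise' ht) t s' rfl htf hs'
            ⟨g, hg, hgj.mixedCross_iff.2 (by tauto)⟩ hgj).trans (SimpleGraph.Adj.reachable ?_)
          refine ⟨?_, s', hgj.isEndpoint.2, hj.isEndpoint.2⟩
          intro h
          replace h : g = e := h
          have := (h ▸ hgj.symm).right_unique hj.symm
          unfold Clockwise at ht
          omega
  have key' : ∀ e, ((incidenceGraph n).induce (crossed D f)).Reachable root e := by
    intro e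
    have := (mixedCross_iff e.1 f).1 e.2.2
    by_cases h : f.Side e.1.left
    · exact key _ _ _ rfl (by tauto) h e e.1.joins_self.symm
    · exact key _ _ _ rfl h (by tauto) e e.1.joins_self
  exact (SimpleGraph.connected_iff _).2 ⟨fun x y => (key' x).symm.trans (key' y), ⟨root⟩⟩

theorem IsTriangulation.isAccordionDiagonal (hn : 3 ≤ n) {T : Finset (HollowDiagonal n)}
    (hT : IsTriangulation T) (f : SolidDiagonal n) : IsAccordionDiagonal T f :=
  isAccordionDiagonal_of_slalomSign hn hT subset_rfl fun _ h h' => absurd h h'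

/-- The two diagonals cut the same quadrilateral in its two different ways into pairs of adjacent
vertices. -/
theorem cross_of_separate {f f' : SolidDiagonal n} {a b c d : Fin n} (h : Clockwise a b c)
    (h' : Clockwise c d a) (hf : (f.Side a ↔ f.Side b) ∧ (f.Side c ↔ f.Side d) ∧
      ¬ (f.Side a ↔ f.Side c)) (hf' : (f'.Side b ↔ f'.Side c) ∧ (f'.Side a ↔ f'.Side d) ∧
      ¬ (f'.Side a ↔ f'.Side c)) : f.Cross f' := by
  have h₁ := f.left_lt_right
  have h₂ := f'.left_lt_right
  unfold Chord.Cross Interlace Chord.Side Clockwise at *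
  grind

/-- A Z and an S at the same `e` separate opposite pairs of sides of its quadrilateral, so diagonals
with opposite signs at `e` cross. -/
theorem sign_coherent (hn : 3 ≤ n) {T : Finset (HollowDiagonal n)} (hT : IsTriangulation T)
    {e : HollowDiagonal n} (he : e ∈ T) {f f' : SolidDiagonal n} (hff : ¬ f.Cross f') :
    0 ≤ slalomSign T e f * slalomSign T e f' := by
  obtain ⟨p, q, hp, hlp, hpr, hq, hrq, hql⟩ := hT.exists_apexes hn he
  have key : ∀ {f f' : SolidDiagonal n}, ¬ f.Cross f' → CrossesZ T e f → ¬ CrossesS T e f' := by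
    intro f f' hff h h'
    rw [crossesZ_iff hT.1 hp hlp hpr hq hrq hql] at h
    rw [crossesS_iff hT.1 hp hlp hpr hq hrq hql] at h'
    exact hff (cross_of_separate hp hq h ⟨h'.1.symm, h'.2⟩)
  have h₁ := key hff
  have h₂ := key (f := f') (f' := f) (by rwa [Chord.cross_comm])
  rw [slalomSign_eq hT.1 he, slalomSign_eq hT.1 he]
  split_ifs <;> simp_all

/-! ### Exchange of crossing diagonals -/

theorem crossing_of_iff {f : SolidDiagonal n} {a b : Fin n} (h : f.Side a ↔ f.Side b) :
    crossing f a b = 0 := if_pos h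

theorem crossing_of_not_iff {f : SolidDiagonal n} {a b : Fin n} (h : ¬ (f.Side a ↔ f.Side b)) :
    crossing f a b = 1 := if_neg h

theorem slalomSign_add_eq (hn : 3 ≤ n) {T : Finset (HollowDiagonal n)} (hT : IsTriangulation T)
    {f f' g g' : SolidDiagonal n} (h : ∀ i j, Linked T i j →
      crossing f i j + crossing f' i j = crossing g i j + crossing g' i j)
    {e : HollowDiagonal n} (he : e ∈ T) :
    slalomSign T e f + slalomSign T e f' = slalomSign T e g + slalomSign T e g' := by
  obtain ⟨p, q, hp, hlp, hpr, hq, hrq, hql⟩ := hT.exists_apexes hn he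
  have key := slalomSign_eq_crossing hT.1 he hp hlp hpr hq hrq hql
  linarith [key f, key f', key g, key g', h _ _ hlp, h _ _ hpr, h _ _ hrq, h _ _ hql.symm]

open Classical in
/-- The number of solid diagonals that cross `f`. -/
def crossNumber (f : SolidDiagonal n) : ℕ := ∑ k : SolidDiagonal n, if k.Cross f then 1 else 0

theorem IsTriangulation.height_eq (hn : 3 ≤ n) {T : Finset (HollowDiagonal n)}
    (hT : IsTriangulation T) (f : SolidDiagonal n) : height T f = crossNumber f := by
  classical
  rw [height, crossNumber, Finset.sum_boole, Nat.cast_id, ← Set.ncard_coe_finset]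
  congr 1
  ext k
  simp [hT.isAccordionDiagonal hn]

theorem crossNumber_add_lt {f f' g g' : SolidDiagonal n} (h : ∀ k : SolidDiagonal n,
      (k.Cross g → k.Cross f ∨ k.Cross f') ∧ (k.Cross g' → k.Cross f ∨ k.Cross f') ∧
      (k.Cross g → k.Cross g' → k.Cross f ∧ k.Cross f'))
    (hff : f'.Cross f) (hg : ¬ f'.Cross g) (hg' : ¬ f'.Cross g') :
    crossNumber g + crossNumber g' < crossNumber f + crossNumber f' := by
  classical
  unfold crossNumber
  rw [← Finset.sum_add_distrib, ← Finset.sum_add_distrib]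
  refine Finset.sum_lt_sum (fun k _ => ?_) ⟨f', Finset.mem_univ _, ?_⟩
  · obtain ⟨h₁, h₂, h₃⟩ := h k
    split_ifs <;> first | omega | (exfalso; tauto)
  · simp [hff, hg, hg']

/-- The crossing of `f` and `f'` can be resolved in two ways. One of them keeps the total crossing
number with every segment of `T`, hence the sum of the signs. Any resolution loses the crossing of
`f` with `f'`, so the heights drop. -/
theorem exists_exchange (hn : 3 ≤ n) {T : Finset (HollowDiagonal n)} (hT : IsTriangulation T)
    {f f' : SolidDiagonal n} (hff : f.Cross f') : ∃ g g' : SolidDiagonal n,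
      (∀ e ∈ T, slalomSign T e f + slalomSign T e f' = slalomSign T e g + slalomSign T e g') ∧
      crossNumber g + crossNumber g' < crossNumber f + crossNumber f' := by
  wlog h : f.left < f'.left generalizing f f'
  · obtain ⟨g, g', h₁, h₂⟩ := this ((Chord.cross_comm _ _).1 hff) (by
      unfold Chord.Cross Interlace at hff; omega)
    exact ⟨g, g', fun e he => by rw [add_comm, h₁ e he], by omega⟩
  have hf := f.left_lt_right
  have hf' := f'.left_lt_right
  have hbc : f'.left < f.right ∧ f.right < f'.right := by
    unfold Chord.Cross Interlace at hff; omega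
  -- The endpoints of `f` and `f'` cut the circle into four arcs. A resolution changes crossing
  -- numbers only for segments joining one particular pair of opposite arcs. Non-crossing segments
  -- of `T` cannot join both pairs, so the resolution is chosen according to which pair is joined.
  by_cases H : ∃ i j, Linked T i j ∧ (f.left < i ∧ i ≤ f'.left) ∧ (f.right < j ∧ j ≤ f'.right)
  · obtain ⟨i, j, hij, hi, hj⟩ := H
    let g : SolidDiagonal n := ⟨(f.left, f'.left), h⟩
    let g' : SolidDiagonal n := ⟨(f.right, f'.right), hbc.2⟩
    have hgl : g.left = f.left := rfl
    have hgr : g.right = f'.left := rfl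
    have hgl' : g'.left = f.right := rfl
    have hgr' : g'.right = f'.right := rfl
    refine ⟨g, g', fun e he => slalomSign_add_eq hn hT (fun a b hab => ?_) he,
      crossNumber_add_lt (fun k => ?_) ?_ ?_ ?_⟩
    · have h₁ := hij.not_cross hT.1 hab
      have h₂ := hij.not_cross hT.1 hab.symm
      unfold Clockwise at h₁ h₂
      have key : ∀ a : Fin n,
          (¬ f.Side a ∧ ¬ f'.Side a ∧ ¬ g.Side a ∧ ¬ g'.Side a ∧ (a < i ∨ j < a)) ∨
          (f.Side a ∧ ¬ f'.Side a ∧ g.Side a ∧ ¬ g'.Side a) ∨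
          (f.Side a ∧ f'.Side a ∧ ¬ g.Side a ∧ ¬ g'.Side a ∧ i < a ∧ a < j) ∨
          (¬ f.Side a ∧ f'.Side a ∧ ¬ g.Side a ∧ g'.Side a) := by
        intro a
        unfold Chord.Side
        rw [hgl, hgr, hgl', hgr']
        clear_value g g'
        clear h₁ h₂
        omega
      unfold crossing
      rcases key a with ha | ha | ha | ha <;> rcases key b with hb | hb | hb | hb <;>
        first | (simp [ha, hb]; done) | (exfalso; omega)
    all_goals
      unfold Chord.Cross Interlace
      try rw [hgl, hgr]
      try rw [hgl', hgr']
      clear_value g g'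
      omega
  · let g : SolidDiagonal n := ⟨(f'.left, f.right), hbc.1⟩
    let g' : SolidDiagonal n := ⟨(f.left, f'.right), h.trans hf'⟩
    have hgl : g.left = f'.left := rfl
    have hgr : g.right = f.right := rfl
    have hgl' : g'.left = f.left := rfl
    have hgr' : g'.right = f'.right := rfl
    refine ⟨g, g', fun e he => slalomSign_add_eq hn hT (fun a b hab => ?_) he,
      crossNumber_add_lt (fun k => ?_) ?_ ?_ ?_⟩
    · have h₁ := fun h => H ⟨a, b, hab, h⟩
      have h₂ := fun h => H ⟨b, a, hab.symm, h⟩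
      rw [imp_false] at h₁ h₂
      have key : ∀ a : Fin n,
          (¬ f.Side a ∧ ¬ f'.Side a ∧ ¬ g.Side a ∧ ¬ g'.Side a) ∨
          (f.Side a ∧ ¬ f'.Side a ∧ ¬ g.Side a ∧ g'.Side a ∧ f.left < a ∧ a ≤ f'.left) ∨
          (f.Side a ∧ f'.Side a ∧ g.Side a ∧ g'.Side a) ∨
          (¬ f.Side a ∧ f'.Side a ∧ ¬ g.Side a ∧ g'.Side a ∧ f.right < a ∧ a ≤ f'.right) := by
        intro a
        unfold Chord.Side
        rw [hgl, hgr, hgl', hgr']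
        clear_value g g'
        clear h₁ h₂
        omega
      unfold crossing
      rcases key a with ha | ha | ha | ha <;> rcases key b with hb | hb | hb | hb <;>
        first | (simp [ha, hb]; done) | (exfalso; omega)
    all_goals
      unfold Chord.Cross Interlace
      try rw [hgl, hgr]
      try rw [hgl', hgr']
      clear_value g g'
      omega

/-! ### Diagonals with a coordinate vector as `g`-vector -/

/-- If every segment of `T` crossed by `f` leaves through `u` or enters at `v`, then `f` pivots
around `u`, then around `v`, and a change of pivot happens only on the segment `uv`. -/
theorem crossesZ_or_crossesS_imp (hn : 3 ≤ n) {T : Finset (HollowDiagonal n)}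
    (hT : IsTriangulation T) {u v : Fin n} (P : Fin n → Prop) {f : SolidDiagonal n}
    (hf : ∀ a b, (f.Side a ↔ f.Side b) ↔ (P a ↔ P b))
    (hP : ∀ a b, Linked T a b → P a → ¬ P b → b = u ∨ a = v)
    {e : HollowDiagonal n} (he : e ∈ T) (h : CrossesZ T e f ∨ CrossesS T e f) : e.Joins u v := by
  obtain ⟨p, q, hp, hlp, hpr, hq, hrq, hql⟩ := hT.exists_apexes hn he
  rw [crossesZ_iff hT.1 hp hlp hpr hq hrq hql, crossesS_iff hT.1 hp hlp hpr hq hrq hql] at h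
  simp only [hf] at h
  have h₁ := hP _ _ hlp
  have h₂ := hP _ _ hpr
  have h₃ := hP _ _ hrq
  have h₄ := hP _ _ hql
  have h₅ := hP _ _ (linked_of_mem he)
  have h₁' := hP _ _ hlp.symm
  have h₂' := hP _ _ hpr.symm
  have h₃' := hP _ _ hrq.symm
  have h₄' := hP _ _ hql.symm
  have h₅' := hP _ _ (linked_of_mem he).symm
  have h₆ := hlp.ne
  have h₇ := hpr.ne
  have h₈ := hrq.ne
  have h₉ := hql.ne
  clear hP hf hlp hpr hrq hql hp hq
  unfold Chord.Joins
  grind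

theorem exists_slalomSign_eq_neg_one (hn : 3 ≤ n) {T : Finset (HollowDiagonal n)}
    (hT : IsTriangulation T) {e : HollowDiagonal n} (he : e ∈ T) : ∃ f : SolidDiagonal n,
      slalomSign T e f = -1 ∧ ∀ e' ∈ T, e' ≠ e → slalomSign T e' f = 0 := by
  have hlr := e.left_lt_right
  -- With the same indices, the solid diagonal is `e` with both endpoints moved one label clockwise.
  refine ⟨e, ?_, fun e' he' hne => ?_⟩
  · obtain ⟨p, q, hp, hlp, hpr, hq, hrq, hql⟩ := hT.exists_apexes hn he
    have hS : CrossesS T e e := by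
      rw [crossesS_iff hT.1 hp hlp hpr hq hrq hql]
      unfold Chord.Side Clockwise at *
      omega
    have hZ : ¬ CrossesZ T e e := fun h => h.not_crossesS hT.1 hS
    simp [slalomSign_eq hT.1 he, hZ, hS]
  · rw [slalomSign_eq_zero_iff hT.1 he', ← not_or]
    refine fun h => hne ((crossesZ_or_crossesS_imp hn hT (Chord.Side e) (fun _ _ => Iff.rfl) ?_
      he' h).eq e.joins_self)
    intro a b hab ha hb
    have h₁ := hab.not_cross hT.1 (linked_of_mem he)
    have h₂ := hab.not_cross hT.1 (linked_of_mem he).symm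
    unfold Chord.Side Clockwise at *
    omega

theorem exists_slalomSign_eq_one (hn : 3 ≤ n) {T : Finset (HollowDiagonal n)}
    (hT : IsTriangulation T) {e : HollowDiagonal n} (he : e ∈ T) : ∃ f : SolidDiagonal n,
      slalomSign T e f = 1 ∧ ∀ e' ∈ T, e' ≠ e → slalomSign T e' f = 0 := by
  have hlr := e.left_lt_right
  -- This time `e` is moved one label counterclockwise; only the partition into sides matters, since
  -- the index can wrap around at vertex 0.
  obtain ⟨f, hf⟩ : ∃ f : SolidDiagonal n, ∀ a b, (f.Side a ↔ f.Side b) ↔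
      ((e.left ≤ a ∧ a < e.right) ↔ (e.left ≤ b ∧ b < e.right)) := by
    obtain ⟨s, hs⟩ := exists_isNext_left e.left
    obtain ⟨s', hs'⟩ := exists_isNext_left e.right
    obtain ⟨f, hf⟩ : ∃ f : Chord n, f.Joins s s' :=
      exists_joins (by unfold IsNext at hs hs'; omega)
    refine ⟨f, fun a b => ?_⟩
    have := f.left_lt_right
    unfold Chord.Joins IsNext at *
    unfold Chord.Side
    omega
  refine ⟨f, ?_, fun e' he' hne => ?_⟩
  · obtain ⟨p, q, hp, hlp, hpr, hq, hrq, hql⟩ := hT.exists_apexes hn he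
    have hZ : CrossesZ T e f := by
      rw [crossesZ_iff hT.1 hp hlp hpr hq hrq hql]
      simp only [hf]
      unfold Clockwise at *
      omega
    simp [slalomSign_eq hT.1 he, hZ]
  · rw [slalomSign_eq_zero_iff hT.1 he', ← not_or]
    refine fun h => hne ((crossesZ_or_crossesS_imp hn hT _ hf (u := e.right) (v := e.left) ?_
      he' h).symm.eq e.joins_self)
    intro a b hab ha hb
    have h₁ := hab.not_cross hT.1 (linked_of_mem he)
    have h₂ := hab.not_cross hT.1 (linked_of_mem he).symm
    unfold Clockwise at *
    omega

/-! ### Uniqueness of non-crossing weights -/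

/-- The weighted number of crossings of the segment joining `a` and `b` with solid diagonals. -/
def weightedCrossing (w : SolidDiagonal n → ℝ) (a b : Fin n) : ℝ := ∑ f, w f * crossing f a b

/-- A nonnegative weight on solid diagonals with pairwise non-crossing support. -/
structure IsLamination (w : SolidDiagonal n → ℝ) : Prop where
  nonneg : ∀ f, 0 ≤ w f
  nonCrossing : ∀ f f', w f ≠ 0 → w f' ≠ 0 → ¬ f.Cross f'

theorem weightedCrossing_comm (w : SolidDiagonal n → ℝ) (a b : Fin n) :
    weightedCrossing w a b = weightedCrossing w b a := by
  simp only [weightedCrossing, crossing_comm]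

theorem crossing_add_le (f : SolidDiagonal n) {a b c d : Fin n} (h : Clockwise a b c)
    (h' : Clockwise c d a) : crossing f a b + crossing f c d ≤ crossing f a c + crossing f b d := by
  have := f.side_iff_of_clockwise h h'
  unfold crossing
  split_ifs <;> first | (norm_num; done) | (exfalso; tauto)

theorem crossing_add_eq (f : SolidDiagonal n) {a b c d : Fin n} (h : Clockwise a b c)
    (h' : Clockwise c d a) (hf : ¬ ((f.Side a ↔ f.Side b) ∧ (f.Side c ↔ f.Side d) ∧
      ¬ (f.Side a ↔ f.Side c))) :
    crossing f a c + crossing f b d = crossing f a b + crossing f c d := by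
  have := f.side_iff_of_clockwise h h'
  unfold crossing
  split_ifs <;> first | (norm_num; done) | (exfalso; tauto)

/-- Each diagonal satisfies both inequalities, and a strict one means that it separates a given pair
of opposite sides. Diagonals strict for different inequalities cross, so one inequality is an
equality for the whole support. -/
theorem IsLamination.ptolemy {w : SolidDiagonal n → ℝ} (hw : IsLamination w) {a b c d : Fin n}
    (h : Clockwise a b c) (h' : Clockwise c d a) :
    weightedCrossing w a c + weightedCrossing w b d =
      max (weightedCrossing w a b + weightedCrossing w c d)
        (weightedCrossing w b c + weightedCrossing w d a) := by
  have hle : ∀ {a b c d : Fin n}, Clockwise a b c → Clockwise c d a →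
      weightedCrossing w a b + weightedCrossing w c d ≤
        weightedCrossing w a c + weightedCrossing w b d := by
    intro a b c d h h'
    simp only [weightedCrossing, ← Finset.sum_add_distrib, ← mul_add]
    exact Finset.sum_le_sum fun f _ => mul_le_mul_of_nonneg_left (crossing_add_le f h h')
      (hw.nonneg f)
  have heq : ∀ {a b c d : Fin n}, Clockwise a b c → Clockwise c d a →
      (∀ f, w f ≠ 0 → ¬ ((f.Side a ↔ f.Side b) ∧ (f.Side c ↔ f.Side d) ∧
        ¬ (f.Side a ↔ f.Side c))) → weightedCrossing w a c + weightedCrossing w b d =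
      weightedCrossing w a b + weightedCrossing w c d := by
    intro a b c d h h' hf
    simp only [weightedCrossing, ← Finset.sum_add_distrib, ← mul_add]
    refine Finset.sum_congr rfl fun f _ => ?_
    by_cases hwf : w f = 0
    · simp [hwf]
    · rw [crossing_add_eq f h h' (hf f hwf)]
  have hbcd : Clockwise b c d ∧ Clockwise d a b := by
    unfold Clockwise at *; omega
  have h₁ := hle h h'
  have h₂ := hle hbcd.1 hbcd.2
  rw [add_comm (weightedCrossing w b d), weightedCrossing_comm w c a] at h₂
  by_cases H : ∃ f, w f ≠ 0 ∧ ((f.Side a ↔ f.Side b) ∧ (f.Side c ↔ f.Side d) ∧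
        ¬ (f.Side a ↔ f.Side c))
  · obtain ⟨f, hf, hfs⟩ := H
    have h₃ := heq hbcd.1 hbcd.2 fun f' hf' hfs' => hw.nonCrossing f f' hf hf'
      (cross_of_separate h h' hfs ⟨hfs'.1, hfs'.2.1.symm, by tauto⟩)
    rw [add_comm (weightedCrossing w b d), weightedCrossing_comm w c a] at h₃
    rw [max_eq_right (by linarith), h₃]
  · push Not at H
    have h₃ := heq h h' fun f hf hfs => hfs.2.2 (H f hf hfs.1 hfs.2.1)
    rw [max_eq_left (by linarith), h₃]

theorem apex_unique {a b b' c : Fin n} (h : Clockwise a b c) (h' : Clockwise a b' c)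
    (h₁ : ¬ (Clockwise a b' b ∧ Clockwise b c a)) (h₂ : ¬ (Clockwise a b b' ∧ Clockwise b' c a)) :
    b = b' := by
  unfold Clockwise at *
  omega

theorem clockwise_of_arcLength_le {a b c b' c' : Fin n} (h : Clockwise a b c)
    (h' : Clockwise a b' c') (hle : arcLength a c ≤ arcLength a c') (hcc : c ≠ c') :
    Clockwise a c c' := by
  have h₁ : a ≠ c ∧ a ≠ c' := by unfold Clockwise at h h'; omega
  clear h h'
  unfold arcLength at hle
  unfold Clockwise
  split_ifs at hle <;> omega

theorem eq_or_clockwise_of_not_cross {a c b' c' : Fin n}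
    (h' : Clockwise a b' c') (hcc : Clockwise a c c')
    (hcross : ¬ (Clockwise c c' a ∧ Clockwise a b' c)) : c = b' ∨ Clockwise a c b' := by
  unfold Clockwise at *
  omega

theorem IsNext.not_clockwise {a b c : Fin n} (h : IsNext a b) : ¬ Clockwise a c b := by
  unfold IsNext Clockwise at *
  omega

/-- Two triangles at `a` are joined by a fan of triangles around `a`. The quadrilateral relation
carries the corner value across each shared side. -/
theorem corner_eq (hn : 3 ≤ n) {T : Finset (Chord n)} (hT : IsTriangulation T)
    {Δ : Fin n → Fin n → ℝ} (hΔ : ∀ a b, Δ a b = Δ b a)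
    (hquad : ∀ a b c d, Clockwise a b c → Clockwise c d a → Linked T a c → Linked T a b →
      Linked T b c → Linked T c d → Linked T d a → Δ a b + Δ c d = Δ b c + Δ d a)
    {a : Fin n} {b c b' c' : Fin n} (h : Clockwise a b c)
    (hab : Linked T a b) (hbc : Linked T b c) (hca : Linked T c a) (h' : Clockwise a b' c')
    (hab' : Linked T a b') (hbc' : Linked T b' c') (hca' : Linked T c' a)
    (hle : arcLength a c ≤ arcLength a c') :
    Δ a b + Δ a c - Δ b c = Δ a b' + Δ a c' - Δ b' c' := by
  induction hm : arcLength a c' using Nat.strong_induction_on generalizing b' c' with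
  | _ m ih =>
    subst hm
    by_cases hcc : c = c'
    · subst hcc
      rw [apex_unique h h' (hab.not_cross hT.1 hbc') (hab'.not_cross hT.1 hbc)]
    · have hcb := eq_or_clockwise_of_not_cross h'
        (clockwise_of_arcLength_le h h' hle hcc) (hca.not_cross hT.1 hbc'.symm)
      obtain ⟨p, hp, hap, hpb⟩ := hT.exists_apex hn hab' (by
        intro hnext
        rcases hcb with rfl | hcb
        exacts [hnext.not_clockwise h, hnext.not_clockwise hcb])
      replace hcb : arcLength a c ≤ arcLength a b' := by
        rcases hcb with rfl | hcb
        exacts [le_rfl, (arcLength_lt_of_clockwise hcb).le]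
      rw [ih _ (arcLength_lt_of_clockwise h') hp hap hpb hab'.symm hcb rfl]
      have := hquad a p b' c' hp (by unfold Clockwise at *; omega) hab' hap hpb hbc' hca'
      linarith [hΔ c' a]

/-- Vanishing shear makes the corner value at `a` independent of the triangle, and `φ a` is half of
it. Adding the corner values at both ends of a side gives twice `Δ` on that side. -/
theorem exists_potential (hn : 3 ≤ n) {T : Finset (Chord n)} (hT : IsTriangulation T)
    {Δ : Fin n → Fin n → ℝ} (hΔ : ∀ a b, Δ a b = Δ b a)
    (hquad : ∀ a b c d, Clockwise a b c → Clockwise c d a → Linked T a c → Linked T a b →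
      Linked T b c → Linked T c d → Linked T d a → Δ a b + Δ c d = Δ b c + Δ d a) :
    ∃ φ : Fin n → ℝ, ∀ a b, Linked T a b → Δ a b = φ a + φ b := by
  have key : ∀ a, ∃ W : ℝ, ∀ b c, Clockwise a b c → Linked T a b → Linked T b c → Linked T c a →
      Δ a b + Δ a c - Δ b c = 2 * W := by
    intro a
    by_cases H : ∃ b c, Clockwise a b c ∧ Linked T a b ∧ Linked T b c ∧ Linked T c a
    · obtain ⟨b, c, h, hab, hbc, hca⟩ := H
      refine ⟨(Δ a b + Δ a c - Δ b c) / 2, fun b' c' h' hab' hbc' hca' => ?_⟩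
      rcases le_total (arcLength a c) (arcLength a c') with hle | hle
      · rw [corner_eq hn hT hΔ hquad h hab hbc hca h' hab' hbc' hca' hle]; ring
      · rw [corner_eq hn hT hΔ hquad h' hab' hbc' hca' h hab hbc hca hle]; ring
    · push Not at H
      exact ⟨0, fun b c h hab hbc hca => absurd hca (H b c h hab hbc)⟩
  choose φ hφ using key
  have key' : ∀ a b, Linked T a b → ¬ IsNext a b → Δ a b = φ a + φ b := by
    intro a b hab h
    obtain ⟨p, hp, hap, hpb⟩ := hT.exists_apex hn hab h
    have h₁ := hφ a p b hp hap hpb hab.symm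
    have h₂ := hφ b a p hp.rotate.rotate hab.symm hap hpb
    linarith [hΔ a b, hΔ b p]
  refine ⟨φ, fun a b hab => ?_⟩
  by_cases h : IsNext a b
  · rw [hΔ, add_comm]
    exact key' b a hab.symm (by unfold IsNext at *; omega)
  · exact key' a b hab h

/-- The diagonal `g` crosses the segment joining `a` and `b`. -/
def Chord.Separates (g : Chord n) (a b : Fin n) : Prop :=
  (Clockwise a g.left b ∧ Clockwise b g.right a) ∨ (Clockwise a g.right b ∧ Clockwise b g.left a)

theorem clockwise_of_not_cross_left {a b p q c d : Fin n} (hp : Clockwise a p b)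
    (hq : Clockwise b q a) (h : ¬ (Clockwise p c q ∧ Clockwise q d p))
    (hcd : Clockwise p c b ∧ Clockwise b d p) : Clockwise a c b ∧ Clockwise b d a := by
  unfold Clockwise at *
  omega

theorem clockwise_of_not_cross_right {a b p q c d : Fin n} (hp : Clockwise a p b)
    (hq : Clockwise b q a) (h : ¬ (Clockwise p d q ∧ Clockwise q c p))
    (hcd : Clockwise q c b ∧ Clockwise b d q) : Clockwise a c b ∧ Clockwise b d a := by
  unfold Clockwise at *
  omega

/-- In the Ptolemy relation for `a`, `p`, `b`, `q`, with `apq` a triangle of `T`, both entries of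
the maximum shift by the same total potential. Thus the formula propagates to `ab` from segments
separated by fewer diagonals: `pq` no longer counts. -/
theorem potential_extends (hn : 3 ≤ n) {T : Finset (Chord n)} (hT : IsTriangulation T)
    {I J : Fin n → Fin n → ℝ}
    (hI : ∀ a b c d, Clockwise a b c → Clockwise c d a →
      I a c + I b d = max (I a b + I c d) (I b c + I d a))
    (hJ : ∀ a b c d, Clockwise a b c → Clockwise c d a →
      J a c + J b d = max (J a b + J c d) (J b c + J d a))
    {φ : Fin n → ℝ} (hφ : ∀ a b, Linked T a b → I a b = J a b + (φ a + φ b)) {a b : Fin n}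
    (hab : a ≠ b) (hIs : ∀ a b, I a b = I b a) (hJs : ∀ a b, J a b = J b a) :
    I a b = J a b + (φ a + φ b) := by
  classical
  induction hm : (T.filter fun g => g.Separates a b).card using Nat.strong_induction_on
    generalizing a b with
  | _ m ih =>
    subst hm
    by_cases hl : Linked T a b
    · exact hφ a b hl
    · obtain ⟨p, q, hp, hq, hap, haq, hpq⟩ := hT.exists_triangle_of_not_linked hn hab hl
      obtain ⟨g, hg, hgj⟩ := hpq.exists_mem (p := b) (q := a) (by unfold Clockwise at *; omega)
        (by unfold Clockwise at *; omega)
      have hcross : ∀ c, (c = p ∨ c = q) → (T.filter fun g => g.Separates c b).card <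
          (T.filter fun g => g.Separates a b).card := by
        intro c hc
        refine Finset.card_lt_card ⟨fun k hk => ?_, fun hsub => ?_⟩
        · rw [Finset.mem_filter] at hk ⊢
          refine ⟨hk.1, ?_⟩
          have hkl := linked_of_mem hk.1
          have h₁ := hpq.not_cross hT.1 hkl
          have h₂ := hpq.not_cross hT.1 hkl.symm
          rcases hc with rfl | rfl
          · exact hk.2.imp (clockwise_of_not_cross_left hp hq h₁)
              (clockwise_of_not_cross_left hp hq h₂)
          · exact hk.2.imp (clockwise_of_not_cross_right hp hq h₂)
              (clockwise_of_not_cross_right hp hq h₁)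
        · have hgs : g ∈ T.filter fun g => g.Separates a b := by
            rw [Finset.mem_filter]
            refine ⟨hg, ?_⟩
            clear hsub
            unfold Chord.Separates
            rcases hgj with ⟨rfl, rfl⟩ | ⟨rfl, rfl⟩ <;> tauto
          have := (Finset.mem_filter.1 (hsub hgs)).2
          unfold Chord.Separates Clockwise at this
          rcases hgj with ⟨rfl, rfl⟩ | ⟨rfl, rfl⟩ <;> omega
      have hpb : p ≠ b := by unfold Clockwise at hp; omega
      have hqb : q ≠ b := by unfold Clockwise at hq; omega
      have h₁ := ih _ (hcross p (Or.inl rfl)) hpb rfl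
      have h₂ := ih _ (hcross q (Or.inr rfl)) hqb rfl
      have h₃ := hI a p b q hp hq
      have h₄ := hJ a p b q hp hq
      rw [hφ a p hap, hIs b q, h₂, h₁, hIs q a, hφ a q haq, hφ p q hpq,
        show J a p + (φ a + φ p) + (J q b + (φ q + φ b)) =
          J a p + J q b + (φ a + φ p + φ q + φ b) by ring,
        show J p b + (φ p + φ b) + (J a q + (φ a + φ q)) =
          J p b + J a q + (φ a + φ p + φ q + φ b) by ring, max_add_add_right] at h₃
      rw [hJs b q, hJs q a] at h₄
      linarith

/-- This is one of the Ptolemy defects of a quadrilateral with two opposite boundary edges as sides.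
Only a diagonal crossing both of these edges contributes, and it must be `f`. -/
theorem second_difference {f : SolidDiagonal n} {x y : Fin n}
    (hx : IsNext f.left x) (hy : IsNext f.right y) (hfi : ¬ f.IsBoundary) (k : SolidDiagonal n) :
    crossing k f.left f.right + crossing k x y - crossing k x f.right - crossing k f.left y =
      if k = f then 2 else 0 := by
  have hf := f.left_lt_right
  have hk := k.left_lt_right
  split_ifs with h
  · subst h
    rw [crossing_of_not_iff, crossing_of_not_iff, crossing_of_iff, crossing_of_iff]
    · norm_num
    all_goals
      unfold Chord.Side IsNext Chord.IsBoundary at *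
      omega
  · have h : ¬ (k.left = f.left ∧ k.right = f.right) := fun h' => h (Chord.ext_ends h'.1 h'.2)
    unfold crossing
    unfold Chord.Side IsNext Chord.IsBoundary at *
    split_ifs <;> first | (norm_num; done) | (exfalso; omega)

/-- Equal shear coordinates force the weighted crossings to differ by a potential, first on `T` and
then on every segment. The second difference that recovers `w f` uses each of its four vertices once
with each sign, so the potential cancels. -/
theorem IsLamination.unique (hn : 3 ≤ n) {T : Finset (HollowDiagonal n)} (hT : IsTriangulation T)
    {w w' : SolidDiagonal n → ℝ} (hw : IsLamination w) (hw' : IsLamination w')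
    (h : ∀ e ∈ T, ∑ f, w f * slalomSign T e f = ∑ f, w' f * slalomSign T e f)
    {f : SolidDiagonal n} (hf : ¬ f.IsBoundary) : w f = w' f := by
  have hlin : ∀ (w : SolidDiagonal n → ℝ) {e : Chord n} (_ : e ∈ T) {p q : Fin n}
      (_ : Clockwise e.left p e.right) (_ : Linked T e.left p) (_ : Linked T p e.right)
      (_ : Clockwise e.right q e.left) (_ : Linked T e.right q) (_ : Linked T q e.left),
      2 * ∑ f, w f * slalomSign T e f = weightedCrossing w e.left q + weightedCrossing w p e.right
        - weightedCrossing w e.left p - weightedCrossing w e.right q := by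
    intro w e he p q hp hlp hpr hq hrq hql
    simp only [weightedCrossing, ← Finset.sum_add_distrib, ← Finset.sum_sub_distrib,
      Finset.mul_sum]
    refine Finset.sum_congr rfl fun f _ => ?_
    linear_combination w f * slalomSign_eq_crossing hT.1 he hp hlp hpr hq hrq hql f
  obtain ⟨φ, hφ⟩ := exists_potential hn hT
    (Δ := fun a b => weightedCrossing w a b - weightedCrossing w' a b)
    (fun a b => by simp only [weightedCrossing_comm w a b, weightedCrossing_comm w' a b]) (by
      intro a b c d h₁ h₂ hac hab hbc hcd hda
      obtain ⟨e, he, hj⟩ := hac.exists_mem h₁ h₂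
      rcases hj with ⟨rfl, rfl⟩ | ⟨rfl, rfl⟩
      · have h₃ := hlin w he h₁ hab hbc h₂ hcd hda
        have h₄ := hlin w' he h₁ hab hbc h₂ hcd hda
        have := h e he
        simp only [weightedCrossing_comm _ d]
        linarith
      · have h₃ := hlin w he h₂ hcd hda h₁ hab hbc
        have h₄ := hlin w' he h₂ hcd hda h₁ hab hbc
        have := h e he
        simp only [weightedCrossing_comm _ b]
        linarith)
  have key : ∀ a b, a ≠ b → weightedCrossing w a b = weightedCrossing w' a b + (φ a + φ b) :=
    fun a b hab => potential_extends hn hT (fun _ _ _ _ => hw.ptolemy) (fun _ _ _ _ => hw'.ptolemy)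
      (fun a b hl => by linarith [hφ a b hl]) hab (weightedCrossing_comm w)
      (weightedCrossing_comm w')
  obtain ⟨x, hx⟩ := exists_isNext f.left
  obtain ⟨y, hy⟩ := exists_isNext f.right
  have hrec : ∀ w : SolidDiagonal n → ℝ, 2 * w f = weightedCrossing w f.left f.right +
      weightedCrossing w x y - weightedCrossing w x f.right - weightedCrossing w f.left y := by
    intro w
    simp only [weightedCrossing, ← Finset.sum_add_distrib, ← Finset.sum_sub_distrib, ← mul_add,
      ← mul_sub, second_difference hx hy hf]
    simp [mul_comm]
  have hne : f.left ≠ f.right ∧ x ≠ y ∧ x ≠ f.right ∧ f.left ≠ y := by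
    have := f.left_lt_right
    unfold IsNext Chord.IsBoundary at *
    omega
  linarith [hrec w, hrec w', key _ _ hne.1, key _ _ hne.2.1, key _ _ hne.2.2.1, key _ _ hne.2.2.2]

/-! ### Linear functionals and cones -/

theorem exists_dotProduct_eq {ι : Type*} [Fintype ι] (l : (ι → ℝ) →ₗ[ℝ] ℝ) :
    ∃ c : ι → ℝ, ∀ x, l x = c ⬝ᵥ x := by
  classical
  refine ⟨fun i => l fun j => if i = j then 1 else 0, fun x => ?_⟩
  rw [LinearMap.pi_apply_eq_sum_univ l x, dotProduct]
  exact Finset.sum_congr rfl fun i _ => mul_comm _ _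

theorem sum_dite_smul {α ι : Type*} [Fintype α] (g : α → ι → ℝ) {S : Finset α}
    [∀ a, Decidable (a ∈ S)] (w : S → ℝ) :
    ∑ a, (if h : a ∈ S then w ⟨a, h⟩ else 0) • g a = ∑ a, w a • g a := by
  symm
  refine Fintype.sum_of_injective (fun a : S => (a : α)) Subtype.val_injective _ _
    (fun a ha => ?_) fun a => ?_
  · rw [dif_neg (fun h => ha ⟨⟨a, h⟩, rfl⟩), zero_smul]
  · rw [dif_pos a.2]

theorem mem_span_image_iff {α ι : Type*} [Fintype α] {g : α → ι → ℝ} {S : Finset α}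
    {x : ι → ℝ} : x ∈ Submodule.span ℝ≥0 (g '' (S : Set α)) ↔
      ∃ w : α → ℝ, (∀ a, 0 ≤ w a) ∧ (∀ a, w a ≠ 0 → a ∈ S) ∧ x = ∑ a, w a • g a := by
  classical
  rw [Submodule.mem_span_image_finset_iff_exists_fun]
  constructor
  · rintro ⟨c, rfl⟩
    refine ⟨fun a => if h : a ∈ S then c ⟨a, h⟩ else 0, fun a => ?_, fun a ha => ?_, ?_⟩
    · dsimp only; split_ifs <;> simp
    · by_contra h; simp [h] at ha
    · exact (sum_dite_smul g fun a => (c a : ℝ)).symm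
  · rintro ⟨w, hw, hS, rfl⟩
    refine ⟨fun a => ⟨w a, hw a⟩, ?_⟩
    refine Fintype.sum_of_injective (fun a : S => (a : α)) Subtype.val_injective _ _
      (fun a ha => ?_) fun a => rfl
    have : w a = 0 := by
      by_contra h
      exact ha ⟨⟨a, hS a h⟩, rfl⟩
    rw [this, zero_smul]

/-- If a linear form attains its maximum on a polyhedron at `x`, and the normal vectors of the
nontrivial inequalities that are tight at `x` are linearly independent, the form is a nonnegative
combination of them. -/
theorem exists_nonneg_combination {α ι : Type*} [Fintype α] [Fintype ι] {g : α → ι → ℝ}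
    {h : α → ℝ} {S : Finset α} {x c : ι → ℝ} (hx : ∀ a, g a ⬝ᵥ x ≤ h a)
    (hS : ∀ a, g a ≠ 0 → g a ⬝ᵥ x = h a → a ∈ S)
    (hind : ∀ w : S → ℝ, ∑ a, w a • g a = 0 → w = 0)
    (hmax : ∀ y, (∀ a, g a ⬝ᵥ y ≤ h a) → c ⬝ᵥ y ≤ c ⬝ᵥ x) :
    ∃ w : α → ℝ, (∀ a, 0 ≤ w a) ∧ (∀ a, w a ≠ 0 → a ∈ S) ∧ c = ∑ a, w a • g a := by
  classical
  let Φ : (S → ℝ) →ₗ[ℝ] (ι → ℝ) := Fintype.linearCombination ℝ fun a : S => g a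
  have hΦ : ∀ w, Φ w = ∑ a, w a • g a := fun w => rfl
  have hker : LinearMap.ker Φ = ⊥ := LinearMap.ker_eq_bot'.2 fun w hw => hind w hw
  -- Independence is used here: an injective linear image of the closed orthant is closed, so `c`
  -- can be separated strictly from the cone.
  have hclosed : IsClosed (Φ '' Set.Ici 0) :=
    (LinearMap.isClosedEmbedding_of_injective hker).isClosedMap _ isClosed_Ici
  have hconv : Convex ℝ (Φ '' Set.Ici 0) := (convex_Ici 0).linear_image Φ
  by_cases hc : c ∈ Φ '' Set.Ici 0
  · obtain ⟨w, hw, rfl⟩ := hc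
    refine ⟨fun a => if h : a ∈ S then w ⟨a, h⟩ else 0, fun a => ?_, fun a ha => ?_, ?_⟩
    · dsimp only
      split_ifs with h
      exacts [hw ⟨a, h⟩, le_rfl]
    · by_contra h; simp [h] at ha
    · exact (sum_dite_smul g w).symm
  · exfalso
    obtain ⟨l, u, hl, hu⟩ := geometric_hahn_banach_closed_point hconv hclosed hc
    obtain ⟨d, hd⟩ := exists_dotProduct_eq l.toLinearMap
    replace hd : ∀ y, l y = y ⬝ᵥ d := fun y => (hd y).trans (dotProduct_comm _ _)
    have hu0 : 0 < u := by simpa using hl 0 ⟨0, Set.mem_Ici.2 le_rfl, map_zero Φ⟩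
    have hgd : ∀ a ∈ S, g a ⬝ᵥ d ≤ 0 := by
      intro a ha
      by_contra! hpos
      have h₁ := hl _ ⟨Pi.single ⟨a, ha⟩ (u / (g a ⬝ᵥ d)), by
        simpa using div_nonneg hu0.le hpos.le, rfl⟩
      rw [hd, Fintype.linearCombination_apply_single, smul_dotProduct, smul_eq_mul,
        div_mul_cancel₀ _ hpos.ne'] at h₁
      exact lt_irrefl _ h₁
    -- A short move from `x` along the separating direction `d` stays in the polyhedron, yet
    -- strictly increases the form `c`.
    have hev : ∀ᶠ ε in nhdsWithin (0 : ℝ) (Set.Ioi 0), ∀ a, g a ⬝ᵥ (x + ε • d) ≤ h a := by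
      refine Filter.eventually_all.2 fun a => ?_
      simp only [dotProduct_add, dotProduct_smul, smul_eq_mul]
      by_cases haS : a ∈ S
      · filter_upwards [self_mem_nhdsWithin] with ε hε
        have := mul_nonpos_of_nonneg_of_nonpos (le_of_lt hε) (hgd a haS)
        linarith [hx a]
      · by_cases hg : g a = 0
        · have := hx a
          simp_all
        · have hlt : g a ⬝ᵥ x < h a := lt_of_le_of_ne (hx a) fun h => haS (hS a hg h)
          have hcont : Filter.Tendsto (fun ε : ℝ => g a ⬝ᵥ x + ε * (g a ⬝ᵥ d))
              (nhdsWithin 0 (Set.Ioi 0)) (nhds (g a ⬝ᵥ x + 0 * (g a ⬝ᵥ d))) :=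
            (Continuous.tendsto (by fun_prop) _).mono_left nhdsWithin_le_nhds
          rw [zero_mul, add_zero] at hcont
          exact (hcont.eventually_lt_const hlt).mono fun _ h => h.le
    obtain ⟨ε, hε, hε0⟩ := (hev.and self_mem_nhdsWithin).exists
    have h₁ := hmax _ hε
    rw [dotProduct_add, dotProduct_smul, smul_eq_mul] at h₁
    have h₂ : 0 < c ⬝ᵥ d := by rw [← hd]; exact hu0.trans hu
    have := mul_pos hε0 h₂
    linarith

/-! ### The associahedron of a triangulation -/

variable {T : Finset (HollowDiagonal n)}

theorem mem_accordiohedron (hn : 3 ≤ n) (hT : IsTriangulation T) {x : T → ℝ} :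
    x ∈ accordiohedron T ↔ ∀ f, gVector T f ⬝ᵥ x ≤ crossNumber f := by
  simp only [accordiohedron, Set.mem_ofPred_eq, hT.isAccordionDiagonal hn, true_imp_iff,
    hT.height_eq hn]

theorem gVector_eq_zero (hn : 3 ≤ n) (hT : IsTriangulation T) {f : SolidDiagonal n}
    (hf : f.IsBoundary) : gVector T f = 0 := by
  ext ⟨e, he⟩
  change slalomSign T e f = 0
  obtain ⟨p, q, hp, hlp, hpr, hq, hrq, hql⟩ := hT.exists_apexes hn he
  rw [slalomSign_eq_zero_iff hT.1 he, crossesZ_iff hT.1 hp hlp hpr hq hrq hql,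
    crossesS_iff hT.1 hp hlp hpr hq hrq hql]
  have := f.left_lt_right
  unfold Chord.IsBoundary at hf
  unfold Clockwise at hp hq
  unfold Chord.Side
  omega

theorem convex_accordiohedron (D : Finset (HollowDiagonal n)) : Convex ℝ (accordiohedron D) := by
  intro x hx y hy a b ha hb hab f hf
  rw [dotProduct_add, dotProduct_smul, dotProduct_smul, smul_eq_mul, smul_eq_mul]
  have h₁ := mul_le_mul_of_nonneg_left (hx f hf) ha
  have h₂ := mul_le_mul_of_nonneg_left (hy f hf) hb
  nlinarith

theorem isClosed_accordiohedron (D : Finset (HollowDiagonal n)) : IsClosed (accordiohedron D) := by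
  simp only [accordiohedron, Set.ofPred_forall]
  refine isClosed_iInter fun f => isClosed_iInter fun _ => isClosed_le ?_ continuous_const
  unfold dotProduct
  fun_prop

/-- Each coordinate vector and its opposite are `g`-vectors, so the inequalities bound every
coordinate on both sides. -/
theorem isCompact_accordiohedron (hn : 3 ≤ n) (hT : IsTriangulation T) :
    IsCompact (accordiohedron T) := by
  have hbound : ∀ e : T, ∃ a b : ℝ, ∀ x ∈ accordiohedron T, x e ∈ Set.Icc a b := by
    rintro ⟨e, he⟩
    obtain ⟨f, hf, hf'⟩ := exists_slalomSign_eq_neg_one hn hT he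
    obtain ⟨k, hk, hk'⟩ := exists_slalomSign_eq_one hn hT he
    refine ⟨-crossNumber f, crossNumber k, fun x hx => ?_⟩
    rw [mem_accordiohedron hn hT] at hx
    have h₁ := hx f
    have h₂ := hx k
    rw [dotProduct, Finset.sum_eq_single_of_mem ⟨e, he⟩ (Finset.mem_univ _)] at h₁ h₂
    · simp only [gVector, hf, hk] at h₁ h₂
      constructor <;> linarith
    · rintro ⟨e', he'⟩ - hne
      simp [gVector, hk' e' he' fun h => hne (Subtype.ext h)]
    · rintro ⟨e', he'⟩ - hne
      simp [gVector, hf' e' he' fun h => hne (Subtype.ext h)]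
  choose a b hab using hbound
  exact (isCompact_univ_pi fun e => isCompact_Icc (a := a e) (b := b e)).of_isClosed_subset
    (isClosed_accordiohedron T) fun x hx e _ => hab e x hx

theorem zero_mem_accordiohedron (D : Finset (HollowDiagonal n)) : 0 ∈ accordiohedron D := by
  intro f _
  simp

theorem not_cross_of_tight (hn : 3 ≤ n) (hT : IsTriangulation T) {x : T → ℝ}
    (hx : x ∈ accordiohedron T) {f f' : SolidDiagonal n}
    (hf : gVector T f ⬝ᵥ x = crossNumber f) (hf' : gVector T f' ⬝ᵥ x = crossNumber f') :
    ¬ f.Cross f' := by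
  intro hff
  obtain ⟨g, g', h₁, h₂⟩ := exists_exchange hn hT hff
  rw [mem_accordiohedron hn hT] at hx
  have h₃ : gVector T f + gVector T f' = gVector T g + gVector T g' := by
    ext ⟨e, he⟩
    exact h₁ e he
  have h₄ := congrArg (fun y => y ⬝ᵥ x) h₃
  simp only [add_dotProduct] at h₄
  have h₅ : (crossNumber g + crossNumber g' : ℝ) < crossNumber f + crossNumber f' := by
    exact_mod_cast h₂
  linarith [hx g, hx g']

theorem IsLamination.eq_of_sum_gVector_eq (hn : 3 ≤ n) (hT : IsTriangulation T)
    {w w' : SolidDiagonal n → ℝ} (hw : IsLamination w) (hw' : IsLamination w')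
    (h : ∑ f, w f • gVector T f = ∑ f, w' f • gVector T f) {f : SolidDiagonal n}
    (hf : ¬ f.IsBoundary) : w f = w' f := by
  refine hw.unique hn hT hw' (fun e he => ?_) hf
  have := congrFun h ⟨e, he⟩
  simpa [Finset.sum_apply, gVector] using this

/-- The positive and negative parts of a relation are two laminations with the same sum, hence equal
by uniqueness; they also have disjoint supports. -/
theorem IsDissection.gVector_independent (hn : 3 ≤ n) (hT : IsTriangulation T)
    {S : Finset (SolidDiagonal n)} (hS : IsDissection S) (w : S → ℝ)
    (hw : ∑ f, w f • gVector T f = 0) : w = 0 := by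
  classical
  have hlam : ∀ v : S → ℝ, (∀ f, 0 ≤ v f) →
      IsLamination fun f => if h : f ∈ S then v ⟨f, h⟩ else 0 := by
    refine fun v hv => ⟨fun f => ?_, fun f f' hf hf' => ?_⟩
    · split_ifs
      exacts [hv _, le_rfl]
    · refine hS.nonCrossing f ?_ f' ?_
      · by_contra h; simp [h] at hf
      · by_contra h; simp [h] at hf'
  ext ⟨f, hf⟩
  have := (hlam (fun f => max (w f) 0) fun f => le_max_right _ _).eq_of_sum_gVector_eq hn hT
    (hlam (fun f => max (- w f) 0) fun f => le_max_right _ _) (by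
      rw [sum_dite_smul _ fun f => max (w f) 0, sum_dite_smul _ fun f => max (- w f) 0, ← sub_eq_zero,
        ← Finset.sum_sub_distrib, ← hw]
      refine Finset.sum_congr rfl fun f _ => ?_
      rw [← sub_smul]
      congr 1
      rcases le_total (w f) 0 with h | h
      · rw [max_eq_right h, max_eq_left (by linarith)]; ring
      · rw [max_eq_left h, max_eq_right (by linarith)]; ring) (hS.internal f hf)
  simp only [hf, dif_pos] at this
  simp only [Pi.zero_apply]
  rcases le_total (w ⟨f, hf⟩) 0 with h | h
  · rw [max_eq_right h, max_eq_left (by linarith)] at this; linarith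
  · rw [max_eq_left h, max_eq_right (by linarith)] at this; linarith

/-- At a maximizer of `c`, the tight internal diagonals do not cross, so their `g`-vectors are
independent and `exists_nonneg_combination` applies. -/
theorem exists_lamination (hn : 3 ≤ n) (hT : IsTriangulation T) (c : T → ℝ) :
    ∃ x ∈ accordiohedron T, ∃ w : SolidDiagonal n → ℝ, IsLamination w ∧
      (∀ f, w f ≠ 0 → ¬ f.IsBoundary ∧ gVector T f ⬝ᵥ x = crossNumber f) ∧
      c = ∑ f, w f • gVector T f := by
  classical
  obtain ⟨x, hx, hmax⟩ := (isCompact_accordiohedron hn hT).exists_isMaxOn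
    ⟨0, zero_mem_accordiohedron T⟩ (f := fun x => c ⬝ᵥ x)
    (Continuous.continuousOn (by unfold dotProduct; fun_prop))
  let S : Finset (SolidDiagonal n) :=
    Finset.univ.filter fun f => ¬ f.IsBoundary ∧ gVector T f ⬝ᵥ x = crossNumber f
  have hmem : ∀ f, f ∈ S ↔ ¬ f.IsBoundary ∧ gVector T f ⬝ᵥ x = crossNumber f := by simp [S]
  have hS : IsDissection S := ⟨fun f hf => ((hmem f).1 hf).1, fun f hf f' hf' =>
    not_cross_of_tight hn hT hx ((hmem f).1 hf).2 ((hmem f').1 hf').2⟩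
  obtain ⟨w, hw, hwS, hc⟩ := exists_nonneg_combination (g := gVector T)
    (h := fun f => (crossNumber f : ℝ)) (S := S) (x := x) (c := c)
    ((mem_accordiohedron hn hT).1 hx)
    (fun f hf hfx => (hmem f).2 ⟨fun h => hf (gVector_eq_zero hn hT h), hfx⟩)
    (hS.gVector_independent hn hT)
    (fun y hy => hmax ((mem_accordiohedron hn hT).2 hy))
  exact ⟨x, hx, w, ⟨hw, fun f f' hf hf' => hS.nonCrossing f (hwS f hf) f' (hwS f' hf')⟩,
    fun f hf => (hmem f).1 (hwS f hf), hc⟩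

/-- Maximize the form given by the weighted sum itself: it becomes a combination of diagonals tight
at the maximizer, and uniqueness says that this is `w`. -/
theorem IsLamination.exists_tight (hn : 3 ≤ n) (hT : IsTriangulation T)
    {w : SolidDiagonal n → ℝ} (hw : IsLamination w) (hint : ∀ f, w f ≠ 0 → ¬ f.IsBoundary) :
    ∃ x ∈ accordiohedron T, ∀ f, w f ≠ 0 → gVector T f ⬝ᵥ x = crossNumber f := by
  obtain ⟨x, hx, w', hw', htight, hsum⟩ := exists_lamination hn hT (∑ f, w f • gVector T f)
  refine ⟨x, hx, fun f hf => (htight f ?_).2⟩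
  rwa [← hw.eq_of_sum_gVector_eq hn hT hw' hsum (hint f hf)]

open Classical in
theorem IsDissection.isLamination {S : Finset (SolidDiagonal n)} (hS : IsDissection S) :
    IsLamination fun f => if f ∈ S then 1 else 0 := by
  refine ⟨fun f => ?_, fun f f' hf hf' => hS.nonCrossing f ?_ f' ?_⟩
  · split_ifs <;> norm_num
  · by_contra h; simp [h] at hf
  · by_contra h; simp [h] at hf'

theorem IsDissection.exists_tight (hn : 3 ≤ n) (hT : IsTriangulation T)
    {S : Finset (SolidDiagonal n)} (hS : IsDissection S) :
    ∃ x ∈ accordiohedron T, ∀ f ∈ S, gVector T f ⬝ᵥ x = crossNumber f := by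
  classical
  obtain ⟨x, hx, h⟩ := hS.isLamination.exists_tight hn hT fun f hf =>
    hS.internal f (by by_contra h; simp [h] at hf)
  exact ⟨x, hx, fun f hf => h f (by simp [hf])⟩

theorem IsTriangulation.mem_of_not_cross (hn : 3 ≤ n) {U : Finset (Chord n)}
    (hU : IsTriangulation U) {f : Chord n} (hf : ¬ f.IsBoundary) (h : ∀ g ∈ U, ¬ f.Cross g) :
    f ∈ U := by
  obtain ⟨g, hg, hgj⟩ := hU.linked_of_not_cross hn f.left_lt_right.ne (by
    rintro c d ⟨g, hg, hgj⟩ hcd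
    have : f.Cross g := (f.joins_self.cross_iff hgj).2 (Or.inl hcd)
    rcases hg with hg | hg
    · exact h g hg this
    · exact hg.not_cross f ((Chord.cross_comm _ _).1 this))
  obtain rfl := hgj.eq f.joins_self
  exact hg.resolve_right hf

theorem IsTriangulation.mem_of_tight (hn : 3 ≤ n) (hT : IsTriangulation T)
    {U : Finset (SolidDiagonal n)} (hU : IsTriangulation U) {x : T → ℝ}
    (hx : x ∈ accordiohedron T) (hxU : ∀ f ∈ U, gVector T f ⬝ᵥ x = crossNumber f)
    {f : SolidDiagonal n} (hf : ¬ f.IsBoundary) (hfx : gVector T f ⬝ᵥ x = crossNumber f) :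
    f ∈ U :=
  hU.mem_of_not_cross hn hf fun g hg => not_cross_of_tight hn hT hx hfx (hxU g hg)

/-- If `f` crosses no element of `S`, complete `S` together with `f` to a triangulation and flip
`f`: the new diagonal is compatible with `S` and crosses `f`. -/
theorem IsDissection.exists_triangulation_notMem (hn : 3 ≤ n) {S : Finset (Chord n)}
    (hS : IsDissection S) {f : Chord n} (hf : ¬ f.IsBoundary) (hfS : f ∉ S) :
    ∃ U, IsTriangulation U ∧ S ⊆ U ∧ f ∉ U := by
  classical
  have hself : ∀ f : Chord n, ¬ f.Cross f := by
    intro f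
    unfold Chord.Cross Interlace
    omega
  have hins : ∀ {f : Chord n}, ¬ f.IsBoundary → (∀ g ∈ S, ¬ f.Cross g) →
      IsDissection (insert f S) := by
    intro f hf h
    refine ⟨fun g hg => ?_, fun g hg g' hg' => ?_⟩
    · rcases Finset.mem_insert.1 hg with rfl | hg
      exacts [hf, hS.internal g hg]
    · rcases Finset.mem_insert.1 hg with rfl | hgS <;>
        rcases Finset.mem_insert.1 hg' with rfl | hgS'
      · exact hself _
      · exact h _ hgS'
      · rw [Chord.cross_comm]; exact h _ hgS
      · exact hS.nonCrossing g hgS g' hgS'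
  by_cases hcr : ∃ g ∈ S, f.Cross g
  · obtain ⟨g, hg, hfg⟩ := hcr
    obtain ⟨U, hU, hSU⟩ := exists_isTriangulation hS
    exact ⟨U, hU, hSU, fun h => hU.1.nonCrossing f h g (hSU hg) hfg⟩
  · push Not at hcr
    obtain ⟨U, hU, hSU⟩ := exists_isTriangulation (hins hf hcr)
    obtain ⟨f', hf', hcr'⟩ := hU.exists_flip hn (hSU (Finset.mem_insert_self f S))
    obtain ⟨U', hU', hSU'⟩ := exists_isTriangulation (hins (f := f')
      (fun h => h.not_cross f hf') fun g hg => hcr' g (hSU (Finset.mem_insert_of_mem hg))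
        fun h => hfS (h ▸ hg))
    exact ⟨U', hU', fun g hg => hSU' (Finset.mem_insert_of_mem hg), fun h =>
      hU'.1.nonCrossing f' (hSU' (Finset.mem_insert_self f' S)) f h hf'⟩

theorem IsLamination.exists_isDissection {w : SolidDiagonal n → ℝ} (hw : IsLamination w)
    (hint : ∀ f, w f ≠ 0 → ¬ f.IsBoundary) :
    ∃ S : Finset (SolidDiagonal n), IsDissection S ∧ ∀ f, f ∈ S ↔ w f ≠ 0 := by
  classical
  have hmem : ∀ f, f ∈ Finset.univ.filter (fun f => w f ≠ 0) ↔ w f ≠ 0 := by simp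
  exact ⟨_, ⟨fun f hf => hint f ((hmem f).1 hf), fun f hf f' hf' =>
    hw.nonCrossing f f' ((hmem f).1 hf) ((hmem f').1 hf')⟩, hmem⟩

theorem sum_gVector_dotProduct_le (hn : 3 ≤ n) (hT : IsTriangulation T)
    {w : SolidDiagonal n → ℝ} (hw : ∀ f, 0 ≤ w f) {x : T → ℝ} (hx : x ∈ accordiohedron T) :
    (∑ f, w f • gVector T f) ⬝ᵥ x ≤ ∑ f, w f * crossNumber f := by
  rw [sum_dotProduct]
  refine Finset.sum_le_sum fun f _ => ?_
  rw [smul_dotProduct, smul_eq_mul]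
  exact mul_le_mul_of_nonneg_left ((mem_accordiohedron hn hT).1 hx f) (hw f)

theorem sum_gVector_dotProduct_eq {w : SolidDiagonal n → ℝ} {x : T → ℝ}
    (hx : ∀ f, w f ≠ 0 → gVector T f ⬝ᵥ x = crossNumber f) :
    (∑ f, w f • gVector T f) ⬝ᵥ x = ∑ f, w f * crossNumber f := by
  rw [sum_dotProduct]
  refine Finset.sum_congr rfl fun f _ => ?_
  rw [smul_dotProduct, smul_eq_mul]
  by_cases hf : w f = 0
  · rw [hf, zero_mul, zero_mul]
  · rw [hx f hf]

theorem tight_of_sum_gVector_dotProduct_ge (hn : 3 ≤ n) (hT : IsTriangulation T)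
    {w : SolidDiagonal n → ℝ} (hw : ∀ f, 0 ≤ w f) {x : T → ℝ} (hx : x ∈ accordiohedron T)
    (h : ∑ f, w f * crossNumber f ≤ (∑ f, w f • gVector T f) ⬝ᵥ x) {f : SolidDiagonal n}
    (hf : w f ≠ 0) : gVector T f ⬝ᵥ x = crossNumber f := by
  have hx' := (mem_accordiohedron hn hT).1 hx
  have h₁ : ∑ f, w f * (crossNumber f - gVector T f ⬝ᵥ x) = 0 := by
    refine le_antisymm ?_ (Finset.sum_nonneg fun f _ =>
      mul_nonneg (hw f) (sub_nonneg.2 (hx' f)))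
    simp only [mul_sub, Finset.sum_sub_distrib]
    rw [sum_dotProduct] at h
    simp only [smul_dotProduct, smul_eq_mul] at h
    linarith
  have h₂ := (Finset.sum_eq_zero_iff_of_nonneg fun f _ =>
      mul_nonneg (hw f) (sub_nonneg.2 (hx' f))).1 h₁ f (Finset.mem_univ _)
  have h₃ := (mul_eq_zero.1 h₂).resolve_left hf
  linarith

theorem isPolytope_accordiohedron (hn : 3 ≤ n) (hT : IsTriangulation T) :
    IsPolytope (accordiohedron T) := by
  have hex : ∀ U : {U : Finset (SolidDiagonal n) // IsTriangulation U},
      ∃ x ∈ accordiohedron T, ∀ f ∈ U.1, gVector T f ⬝ᵥ x = crossNumber f :=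
    fun U => U.2.1.exists_tight hn hT
  choose v hv hvt using hex
  refine ⟨Set.range v, Set.finite_range v, Set.Subset.antisymm
    (convexHull_min (Set.range_subset_iff.2 hv) (convex_accordiohedron T)) fun y hy => ?_⟩
  by_contra hyv
  obtain ⟨l, u, hl, hu⟩ := geometric_hahn_banach_closed_point (convex_convexHull ℝ _)
    ((Set.finite_range v).isCompact_convexHull ℝ).isClosed hyv
  obtain ⟨c, hc⟩ := exists_dotProduct_eq l.toLinearMap
  replace hc : ∀ z, l z = c ⬝ᵥ z := hc
  obtain ⟨x, hx, w, hw, hwt, hsum⟩ := exists_lamination hn hT c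
  obtain ⟨S, hS, hSw⟩ := hw.exists_isDissection fun f hf => (hwt f hf).1
  obtain ⟨U, hU, hSU⟩ := exists_isTriangulation hS
  have h₁ := hl _ (subset_convexHull ℝ _ ⟨⟨U, hU⟩, rfl⟩)
  rw [hc, hsum, sum_gVector_dotProduct_eq fun f hf => hvt ⟨U, hU⟩ f (hSU ((hSw f).2 hf))] at h₁
  rw [hc, hsum] at hu
  linarith [sum_gVector_dotProduct_le hn hT hw.nonneg hy]

/-! ### Coordinate projections -/

variable {D : Finset (HollowDiagonal n)}

open Classical in
/-- Extension of a vector by zero to the diagonals of `T` outside `D`. -/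
def extendZero (T : Finset (HollowDiagonal n)) (c : D → ℝ) : T → ℝ :=
  fun e => if h : e.1 ∈ D then c ⟨e.1, h⟩ else 0

theorem extendZero_dotProduct (hDT : D ⊆ T) (c : D → ℝ) (x : T → ℝ) :
    extendZero T c ⬝ᵥ x = c ⬝ᵥ coordProjection hDT x := by
  symm
  refine Fintype.sum_of_injective (fun e : D => (⟨e.1, hDT e.2⟩ : T))
    (fun e e' h => Subtype.ext (congrArg (fun e : T => e.1) h)) _ _ (fun e he => ?_) fun e => ?_
  · rw [extendZero, dif_neg (fun h => he ⟨⟨e.1, h⟩, rfl⟩), zero_mul]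
  · rw [extendZero, dif_pos e.2]
    rfl

theorem gVector_eq_extendZero (hn : 3 ≤ n) (hT : IsDissection T) (hDT : D ⊆ T)
    {f : SolidDiagonal n} (hf : IsAccordionDiagonal D f) :
    gVector T f = extendZero T (gVector D f) := by
  ext ⟨e, he⟩
  unfold extendZero
  split_ifs with h
  · exact hf.slalomSign_eq hn hT hDT h
  · exact hf.slalomSign_eq_zero hn hT hDT he h

theorem sum_gVector_eq_extendZero (hn : 3 ≤ n) (hT : IsDissection T) (hDT : D ⊆ T)
    {w : SolidDiagonal n → ℝ} (hw : ∀ f, w f ≠ 0 → IsAccordionDiagonal D f) :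
    ∑ f, w f • gVector T f = extendZero T (∑ f, w f • gVector D f) := by
  have : ∀ f, w f • gVector T f = w f • extendZero T (gVector D f) := by
    intro f
    by_cases hf : w f = 0
    · rw [hf, zero_smul, zero_smul]
    · rw [gVector_eq_extendZero hn hT hDT (hw f hf)]
  rw [Finset.sum_congr rfl fun f _ => this f]
  ext e
  simp only [Finset.sum_apply, Pi.smul_apply, extendZero]
  split_ifs <;> simp

theorem extendZero_injective (hDT : D ⊆ T) {c c' : D → ℝ}
    (h : extendZero T c = extendZero T c') : c = c' := by
  ext e
  have := congrFun h ⟨e.1, hDT e.2⟩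
  simpa [extendZero] using this

/-- By sign coherence there is no cancellation in a coordinate outside `D`: the sum vanishes there
only if each diagonal of the support has coordinate zero. -/
theorem IsLamination.isAccordionDiagonal (hn : 3 ≤ n) (hT : IsTriangulation T) (hDT : D ⊆ T)
    {w : SolidDiagonal n → ℝ} (hw : IsLamination w) {c : D → ℝ}
    (hc : extendZero T c = ∑ f, w f • gVector T f) {f : SolidDiagonal n} (hf : w f ≠ 0) :
    IsAccordionDiagonal D f := by
  refine isAccordionDiagonal_of_slalomSign hn hT hDT fun e heT heD => ?_
  have h₁ : ∑ k, w k * slalomSign T e k = 0 := by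
    have := congrFun hc ⟨e, heT⟩
    simp only [extendZero, heD, Finset.sum_apply, Pi.smul_apply, smul_eq_mul, dif_neg,
      not_false_eq_true, gVector] at this
    exact this.symm
  have h₂ : ∑ k, w k * (slalomSign T e f * slalomSign T e k) = 0 := by
    rw [← mul_zero (slalomSign T e f), ← h₁, Finset.mul_sum]
    exact Finset.sum_congr rfl fun k _ => by ring
  have h₃ := (Finset.sum_eq_zero_iff_of_nonneg fun k _ => ?_).1 h₂ f (Finset.mem_univ _)
  · simpa [hf] using h₃
  · by_cases hk : w k = 0
    · rw [hk, zero_mul]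
    · exact mul_nonneg (hw.nonneg k) (sign_coherent hn hT heT (hw.nonCrossing f k hf hk))

theorem exists_lamination_projection (hn : 3 ≤ n) (hT : IsTriangulation T) (hDT : D ⊆ T)
    (c : D → ℝ) : ∃ x ∈ accordiohedron T, ∃ w : SolidDiagonal n → ℝ, IsLamination w ∧
      (∀ f, w f ≠ 0 → ¬ f.IsBoundary ∧ gVector T f ⬝ᵥ x = crossNumber f ∧
        IsAccordionDiagonal D f) ∧ c = ∑ f, w f • gVector D f := by
  obtain ⟨x, hx, w, hw, hwt, hc⟩ := exists_lamination hn hT (extendZero T c)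
  have hacc := fun f hf => hw.isAccordionDiagonal hn hT hDT hc (f := f) hf
  refine ⟨x, hx, w, hw, fun f hf => ⟨(hwt f hf).1, (hwt f hf).2, hacc f hf⟩, ?_⟩
  exact extendZero_injective hDT (hc.trans (sum_gVector_eq_extendZero hn hT.1 hDT hacc))

theorem normalCone_eq_span (hn : 3 ≤ n) (hT : IsTriangulation T) (hDT : D ⊆ T)
    {w : SolidDiagonal n → ℝ} (hw : ∀ f, 0 ≤ w f) {S : Finset (SolidDiagonal n)}
    (hS : IsAccordionDissection D S) (hSw : ∀ f, f ∈ S ↔ w f ≠ 0) {F : Set (D → ℝ)}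
    (hF : F = {x ∈ coordProjection hDT '' accordiohedron T |
      ∀ y ∈ coordProjection hDT '' accordiohedron T,
        (∑ f, w f • gVector D f) ⬝ᵥ y ≤ (∑ f, w f • gVector D f) ⬝ᵥ x}) :
    normalCone (coordProjection hDT '' accordiohedron T) F =
      (Submodule.span ℝ≥0 (gVector D '' (S : Set (SolidDiagonal n))) : Set (D → ℝ)) := by
  have hdot : ∀ {w : SolidDiagonal n → ℝ}, (∀ f, w f ≠ 0 → IsAccordionDiagonal D f) →
      ∀ x : T → ℝ, (∑ f, w f • gVector D f) ⬝ᵥ coordProjection hDT x =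
        (∑ f, w f • gVector T f) ⬝ᵥ x := fun hw x => by
    rw [sum_gVector_eq_extendZero hn hT.1 hDT hw, extendZero_dotProduct]
  have hwacc : ∀ f, w f ≠ 0 → IsAccordionDiagonal D f := fun f hf => hS.2 f ((hSw f).2 hf)
  have hFmem : ∀ x ∈ accordiohedron T, (∀ f ∈ S, gVector T f ⬝ᵥ x = crossNumber f) →
      coordProjection hDT x ∈ F := by
    intro x hx hxt
    rw [hF]
    refine ⟨⟨x, hx, rfl⟩, ?_⟩
    rintro _ ⟨y, hy, rfl⟩
    rw [hdot hwacc, hdot hwacc, sum_gVector_dotProduct_eq fun f hf => hxt f ((hSw f).2 hf)]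
    exact sum_gVector_dotProduct_le hn hT hw hy
  ext c
  rw [SetLike.mem_coe, mem_span_image_iff]
  constructor
  · intro hc
    obtain ⟨x, hx, w', hw', hw't, rfl⟩ := exists_lamination_projection hn hT hDT c
    refine ⟨w', hw'.nonneg, fun f hf => ?_, rfl⟩
    by_contra hfS
    -- A vertex `z` belonging to a triangulation that contains `S` but not `f` projects into `F`, so
    -- `c` is maximal there too. This forces `f` to be tight at `z`, hence to cross nothing in `U`
    -- and to belong to it.
    obtain ⟨U, hU, hSU, hfU⟩ := hS.1.exists_triangulation_notMem hn (hw't f hf).1 hfS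
    obtain ⟨z, hz, hzt⟩ := hU.1.exists_tight hn hT
    have h₁ := hc _ (hFmem z hz fun f hf => hzt f (hSU hf)) _ ⟨x, hx, rfl⟩
    have hacc := fun f hf => (hw't f hf).2.2
    rw [hdot hacc, hdot hacc, sum_gVector_dotProduct_eq fun f hf => (hw't f hf).2.1] at h₁
    exact hfU (hT.mem_of_tight hn hU hz hzt (hw't f hf).1
      (tight_of_sum_gVector_dotProduct_ge hn hT hw'.nonneg hz h₁ hf))
  · rintro ⟨w', hw', hw'S, rfl⟩ x hx _ ⟨y, hy, rfl⟩
    rw [hF] at hx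
    obtain ⟨⟨x, hx, rfl⟩, hmax⟩ := hx
    obtain ⟨z, hz, hzt⟩ := hS.1.exists_tight hn hT
    have h₁ := hmax _ ⟨z, hz, rfl⟩
    rw [hdot hwacc, hdot hwacc, sum_gVector_dotProduct_eq fun f hf => hzt f ((hSw f).2 hf)] at h₁
    have hacc : ∀ f, w' f ≠ 0 → IsAccordionDiagonal D f := fun f hf => hS.2 f (hw'S f hf)
    rw [hdot hacc, hdot hacc, sum_gVector_dotProduct_eq (x := x) fun f hf =>
      tight_of_sum_gVector_dotProduct_ge hn hT hw hx h₁ ((hSw f).1 (hw'S f hf))]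
    exact sum_gVector_dotProduct_le hn hT hw' hy

theorem normalFan_projection (hn : 3 ≤ n) (hT : IsTriangulation T) (hDT : D ⊆ T) :
    normalFan (coordProjection hDT '' accordiohedron T) = gVectorFan D := by
  classical
  ext K
  constructor
  · rintro ⟨F, hne, hexp, rfl⟩
    obtain ⟨l, hl⟩ := hexp hne
    obtain ⟨c, hc⟩ := exists_dotProduct_eq l.toLinearMap
    replace hc : ∀ z, l z = c ⬝ᵥ z := hc
    simp only [hc] at hl
    obtain ⟨x, hx, w, hw, hwt, rfl⟩ := exists_lamination_projection hn hT hDT c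
    obtain ⟨S, hS, hSw⟩ := hw.exists_isDissection fun f hf => (hwt f hf).1
    have hSacc : IsAccordionDissection D S := ⟨hS, fun f hf => (hwt f ((hSw f).1 hf)).2.2⟩
    exact ⟨S, hSacc, normalCone_eq_span hn hT hDT hw.nonneg hSacc hSw hl⟩
  · rintro ⟨S, hS, rfl⟩
    -- Any strictly positive weights on `S` would do: they put the form in the relative interior of
    -- the cone, so that its maximizers are the face whose normal cone is exactly that cone.
    let w : SolidDiagonal n → ℝ := fun f => if f ∈ S then 1 else 0
    have hSw : ∀ f, f ∈ S ↔ w f ≠ 0 := by simp [w]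
    let c : D → ℝ := ∑ f, w f • gVector D f
    have hcompact : IsCompact (coordProjection hDT '' accordiohedron T) :=
      (isCompact_accordiohedron hn hT).image
        (LinearMap.continuous_of_finiteDimensional (coordProjection hDT))
    obtain ⟨y, hy, hmax⟩ := hcompact.exists_isMaxOn
      (Set.Nonempty.image _ ⟨0, zero_mem_accordiohedron T⟩) (f := fun x => c ⬝ᵥ x)
      (Continuous.continuousOn (by unfold dotProduct; fun_prop))
    refine ⟨{x ∈ coordProjection hDT '' accordiohedron T |
      ∀ y ∈ coordProjection hDT '' accordiohedron T, c ⬝ᵥ y ≤ c ⬝ᵥ x}, ⟨y, hy, hmax⟩, fun _ => ⟨LinearMap.toContinuousLinearMap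
      (dotProductBilin ℝ ℝ c), rfl⟩, (normalCone_eq_span hn hT hDT
        hS.1.isLamination.nonneg hS hSw rfl).symm⟩

end Accordion

end

theorem mainTheorem6 (n : ℕ) (hn : 3 ≤ n) (D : Finset (Accordion.HollowDiagonal n))
    (hD : Accordion.IsDissection D) :
    (∃ T : Finset (Accordion.HollowDiagonal n), Accordion.IsTriangulation T ∧ D ⊆ T) ∧
    ∀ (T : Finset (Accordion.HollowDiagonal n)) (_ : Accordion.IsTriangulation T) (hDT : D ⊆ T),
      Accordion.IsRealizedBy (Accordion.gVectorFan D)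
        (Accordion.coordProjection hDT '' Accordion.accordiohedron T) := by
  refine ⟨Accordion.exists_isTriangulation hD, fun T hT hDT => ⟨?_, ?_⟩⟩
  · obtain ⟨V, hV, hVT⟩ := Accordion.isPolytope_accordiohedron hn hT
    exact ⟨Accordion.coordProjection hDT '' V, hV.image _, by
      rw [← hVT, LinearMap.image_convexHull]⟩
  · exact Accordion.normalFan_projection hn hT hDT
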